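/- **Setting.** Let $\mathbb{D}$ be the open unit disc and $\mathbb{T}$ the unit circle. Let $\mathcal{D}$ be the Fréchet space of smooth functions on $\mathbb{T}$, with the seminorms $\|f\|_\alpha=\left(\sum_{k\in\mathbb{Z}}|\hat f(k)|^2(1+|k|)^\alpha\right)^{1/2}$, $\alpha>0$, where $\hat f(k)=\frac1{2\pi}\int_0^{2\pi}f(e^{it})e^{-ikt}\,dt$. Let $\mathcal{D}'$ be its topological dual (the distributions on $\mathbb{T}$), and $\mathcal{D}_a$ the space of functions that are analytic on $\mathbb{D}$ and smooth on $\overline{\mathbb{D}}$. For $\mu\in\mathcal{D}'$ put $\hat\mu(k)=\mu(\zeta^{-k})$ for $k\in\mathbb{Z}$, and $P_\mu(z)=\mu(P_z)$ for $z\in\mathbb{D}$, where $P_z(\zeta)=\frac{1-|z|^2}{|\zeta-z|^2}$. Call $\mu$ real if $\mu(f)\in\mathbb{R}$ for every real-valued $f\in\mathcal{D}$ (equivalently $\hat\mu(-k)=\overline{\hat\mu(k)}$ for all $k$), and write $\mu\ge0$ if $\mu(f)\ge 0$ for every $f\in\mathcal{D}$ with $f\ge 0$. Let $D$ be the operator on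 $\mathcal{D}'$ given by $\widehat{D\mu}(k)=|k|\hat\mu(k)$. A finite measure $\nu$ on $\mathbb{T}$ is identified with the distribution $f\mapsto\int_{\mathbb{T}} f\,d\nu$. For $\mu\in\mathcal{D}'$ and $f\in\mathcal{D}_a$ let $$\mathcal{D}_{\mu,0}(f)=\lim_{r\to1^-}\frac1{2\pi}\int_0^{2\pi}|f(re^{it})|^2P_\mu(re^{it})\,dt,$$ $$\mathcal{D}_{\mu,n}(f)=\lim_{r\to1^-}\frac{1}{n!\,(n-1)!\,\pi}\int_{r\mathbb{D}}|f^{(n)}(z)|^2P_\mu(z)(1-|z|^2)^{n-1}\,dA(z)\qquad(n\ge1).$$ For a tuple $\vec\mu=(\mu_0,\dots,\mu_{m-1})\in(\mathcal{D}')^m$ let $\|f\|_{\vec\mu}^2=\sum_{n=0}^{m-1}\mathcal{D}_{\mu_n,n}(f)$. The tuple is *allowable* if there is $C>0$ such that $0\le\|zf\|_{\vec\mu}^2\le C^2\|f\|_{\vec\mu}^2$ for all $f\in\mathcal{D}_a$. For $\mu\in\mathcal{D}'$, $\mu e_n$ denotes the $m$-tuple with $\mu$ in position $n$ and $0$ in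 all other positions. **Theorem 5.5.** Let $m\ge3$, let $\vec\mu=(\mu_0,\dots,\mu_{m-1})$ be an $m$-tuple of real distributions on $\mathbb{T}$, and let $\nu\in\mathcal{D}'$. Assume that 1. $\nu\ge0$, and there is $K>0$ such that $|\hat f(0)|^2\le K\,\mathcal{D}_{\nu,0}(f)$ for all $f\in\mathcal{D}_a$; 2. if $0\le n\le\frac{m-3}{2}$, then there is $K_n>0$ such that $|\hat\mu_n(k)|\le K_n(1+|k|)^{\frac{m-3}{2}}$ for all $k\in\mathbb{Z}$; 3. if $m$ is even and $n=\frac{m-2}{2}$, then $\mu_n=\sum_{j=0}^{(m-4)/2}D^j\nu_{n,j}$, where each $\nu_{n,j}$ is a finite measure on $\mathbb{T}$; 4. if $\frac{m-1}{2}\le n\le m-2$, then $\mu_n=\sum_{j=0}^{m-2-n}D^j\nu_{n,j}$, where each $\nu_{n,j}$ is a finite measure on $\mathbb{T}$; 5. there is $c>0$ such that $P_{\mu_{m-1}}(z)\ge c$ for all $z\in\mathbb{D}$. Then there is $C_0>0$ such that for every $C\ge C_0$ the tuple $C\nu e_0+\vec\mu+C\mu_{m-1}e_{m-1}$ is allowable.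 -/

import Mathlib

open Filter Topology MeasureTheory
open scoped ContDiff ComplexOrder Nat

noncomputable section

namespace CircleDirichlet

/-! ## Smooth functions and distributions on the unit circle -/

/-- `f : 𝕋 → ℂ` is smooth: `t ↦ f (e^{it})` is a `C^∞` function on the real line. -/
def IsSmoothOnCircle (f : Circle → ℂ) : Prop :=
  ContDiff ℝ ∞ fun t : ℝ => f (Circle.exp t)

/-- The Fourier coefficient
`(1 / 2π) ∫_𝕋 f(ζ) ζ^{-k} |dζ| = (1 / 2π) ∫_0^{2π} f(e^{it}) e^{-ikt} dt`. -/
def circleCoeff (f : Circle → ℂ) (k : ℤ) : ℂ :=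
  ((2 * Real.pi)⁻¹ : ℝ) *
    ∫ t in (0 : ℝ)..2 * Real.pi, f (Circle.exp t) * ((Circle.exp t ^ (-k) : Circle) : ℂ)

/-- The complex vector space of smooth functions on the circle, as a subspace of all functions. -/
def smoothSubmodule : Submodule ℂ (Circle → ℂ) where
  carrier := {f | IsSmoothOnCircle f}
  zero_mem' := contDiff_zero_fun (𝕜 := ℝ) (E := ℝ) (F := ℂ) (n := ∞)
  add_mem' {f g} hf hg := by
    have hf' : IsSmoothOnCircle f := hf
    have hg' : IsSmoothOnCircle g := hg
    exact ContDiff.add hf' hg'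
  smul_mem' c f hf := by
    have hf' : IsSmoothOnCircle f := hf
    exact ContDiff.smul contDiff_const hf'

/-- The space `𝒟` of smooth functions on the circle. (A type of its own, so that it does not
inherit the topology of pointwise convergence.) -/
def SmoothFun : Type := smoothSubmodule

instance : AddCommGroup SmoothFun := inferInstanceAs (AddCommGroup smoothSubmodule)
instance : Module ℂ SmoothFun := inferInstanceAs (Module ℂ smoothSubmodule)

/-- The function underlying an element of `𝒟`. -/
def SmoothFun.toFun (f : SmoothFun) : Circle → ℂ := f.1

/-- The element of `𝒟` given by a smooth function. -/
def SmoothFun.mk (f : Circle → ℂ) (hf : IsSmoothOnCircle f) : SmoothFun := ⟨f, hf⟩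

lemma SmoothFun.smooth (f : SmoothFun) : ContDiff ℝ ∞ fun t : ℝ => f.toFun (Circle.exp t) :=
  f.2

lemma SmoothFun.continuous_exp (f : SmoothFun) : Continuous fun t : ℝ => f.toFun (Circle.exp t) :=
  f.smooth.continuous

lemma coe_exp_zpow (t : ℝ) (k : ℤ) :
    ((Circle.exp t ^ k : Circle) : ℂ) = Complex.exp (k * Complex.I * t) := by
  rw [Circle.coe_zpow, Circle.coe_exp, ← Complex.exp_int_mul]
  congr 1
  ring

lemma circleCoeff_eq (f : Circle → ℂ) (k : ℤ) :
    circleCoeff f k = ((2 * Real.pi)⁻¹ : ℝ) *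
      ∫ t in (0 : ℝ)..2 * Real.pi, f (Circle.exp t) * Complex.exp ((-k : ℤ) * Complex.I * t) := by
  simp only [circleCoeff, coe_exp_zpow]

lemma integral_deriv_mul_exp {g : ℝ → ℂ} (hg : ContDiff ℝ ∞ g)
    (hp : Function.Periodic g (2 * Real.pi)) (k : ℤ) :
    ∫ t in (0 : ℝ)..2 * Real.pi, deriv g t * Complex.exp ((-k : ℤ) * Complex.I * t) =
      k * Complex.I *
        ∫ t in (0 : ℝ)..2 * Real.pi, g t * Complex.exp ((-k : ℤ) * Complex.I * t) := by
  have hv : ∀ t : ℝ, HasDerivAt (fun t : ℝ => Complex.exp ((-k : ℤ) * Complex.I * t))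
      (Complex.exp ((-k : ℤ) * Complex.I * t) * ((-k : ℤ) * Complex.I)) t := by
    intro t
    have h1 : HasDerivAt (fun t : ℝ => ((-k : ℤ) : ℂ) * Complex.I * (t : ℂ))
        (((-k : ℤ) : ℂ) * Complex.I * 1) t :=
      HasDerivAt.const_mul _ Complex.ofRealCLM.hasDerivAt
    simpa using h1.cexp
  have hu : ∀ t : ℝ, HasDerivAt g (deriv g t) t := fun t =>
    (hg.differentiable (by simp)).differentiableAt.hasDerivAt
  have hc : Continuous (deriv g) := hg.continuous_deriv (by simp)
  have hmain := intervalIntegral.integral_deriv_mul_eq_sub (a := 0) (b := 2 * Real.pi)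
    (fun t _ => hu t) (fun t _ => hv t) (hc.intervalIntegrable _ _)
    (Continuous.intervalIntegrable (by fun_prop) _ _)
  have hI1 : IntervalIntegrable (fun t : ℝ => deriv g t * Complex.exp ((-k : ℤ) * Complex.I * t))
      volume 0 (2 * Real.pi) := Continuous.intervalIntegrable (by fun_prop) _ _
  have hgc : Continuous g := hg.continuous
  have hI2 : IntervalIntegrable (fun t : ℝ => g t * (Complex.exp ((-k : ℤ) * Complex.I * t) *
      ((-k : ℤ) * Complex.I))) volume 0 (2 * Real.pi) :=
    Continuous.intervalIntegrable (by fun_prop) _ _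
  rw [intervalIntegral.integral_add hI1 hI2] at hmain
  have hz : g (2 * Real.pi) = g 0 := by simpa using hp 0
  have he : Complex.exp ((-k : ℤ) * Complex.I * ((2 * Real.pi : ℝ) : ℂ)) = 1 := by
    rw [← Complex.exp_int_mul_two_pi_mul_I (-k)]
    congr 1
    push_cast
    ring
  rw [hz, he] at hmain
  simp only [Complex.ofReal_zero, mul_zero, Complex.exp_zero, sub_self] at hmain
  rw [eq_neg_of_add_eq_zero_left hmain, ← intervalIntegral.integral_const_mul,
    ← intervalIntegral.integral_neg]
  congr 1
  ext t
  push_cast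
  ring

lemma decay_aux (N : ℕ) : ∀ g : ℝ → ℂ, ContDiff ℝ ∞ g → Function.Periodic g (2 * Real.pi) →
    ∃ M : ℝ, 0 ≤ M ∧ ∀ k : ℤ, |(k : ℝ)| ^ N *
      ‖∫ t in (0 : ℝ)..2 * Real.pi, g t * Complex.exp ((-k : ℤ) * Complex.I * t)‖ ≤ M := by
  induction N with
  | zero =>
    intro g hg _
    refine ⟨∫ t in (0 : ℝ)..2 * Real.pi, ‖g t‖, intervalIntegral.integral_nonneg
      Real.two_pi_pos.le fun t _ => norm_nonneg _, fun k => ?_⟩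
    rw [pow_zero, one_mul]
    refine (intervalIntegral.norm_integral_le_integral_norm Real.two_pi_pos.le).trans_eq ?_
    congr 1
    ext t
    have : ((-k : ℤ) : ℂ) * Complex.I * t = ((-k * t : ℝ) : ℂ) * Complex.I := by
      push_cast
      ring
    rw [norm_mul, this, Complex.norm_exp_ofReal_mul_I, mul_one]
  | succ N ih =>
    intro g hg hp
    have hg' : ContDiff ℝ ∞ (deriv g) := by
      exact (contDiff_infty_iff_deriv.1 hg).2
    have hp' : Function.Periodic (deriv g) (2 * Real.pi) := by
      intro t
      have : (fun s => g (s + 2 * Real.pi)) = g := funext hp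
      rw [← deriv_comp_add_const, this]
    obtain ⟨M, hM, h⟩ := ih (deriv g) hg' hp'
    refine ⟨M, hM, fun k => ?_⟩
    have hk := h k
    rw [integral_deriv_mul_exp hg hp, norm_mul, norm_mul, Complex.norm_I, mul_one,
      Complex.norm_intCast, ← mul_assoc, ← pow_succ] at hk
    exact hk

/-- Fourier coefficients of smooth functions decay rapidly. -/
lemma circleCoeff_decay (f : SmoothFun) (N : ℕ) :
    ∃ M : ℝ, 0 ≤ M ∧ ∀ k : ℤ, (1 + |(k : ℝ)|) ^ N * ‖circleCoeff f.toFun k‖ ≤ M := by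
  have hp : Function.Periodic (fun t : ℝ => f.toFun (Circle.exp t)) (2 * Real.pi) := by
    intro t
    simp
  obtain ⟨M₀, hM₀, h₀⟩ := decay_aux 0 _ f.smooth hp
  obtain ⟨M₁, hM₁, h₁⟩ := decay_aux N _ f.smooth hp
  have hpi : (0 : ℝ) ≤ (2 * Real.pi)⁻¹ := inv_nonneg.2 Real.two_pi_pos.le
  refine ⟨(2 * Real.pi)⁻¹ * (2 ^ N * (M₀ + M₁)), by positivity, fun k => ?_⟩
  rw [circleCoeff_eq, norm_mul, Complex.norm_real, Real.norm_of_nonneg hpi, mul_left_comm]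
  refine mul_le_mul_of_nonneg_left ?_ hpi
  have h0 := h₀ k
  have h1 := h₁ k
  set A := ‖∫ t in (0 : ℝ)..2 * Real.pi,
    f.toFun (Circle.exp t) * Complex.exp ((-k : ℤ) * Complex.I * t)‖ with hA
  have hA0 : 0 ≤ A := norm_nonneg _
  change |(k : ℝ)| ^ 0 * A ≤ M₀ at h0
  change |(k : ℝ)| ^ N * A ≤ M₁ at h1
  have hb : (1 + |(k : ℝ)|) ^ N ≤ 2 ^ N * (1 + |(k : ℝ)| ^ N) := by
    rcases le_total |(k : ℝ)| 1 with h | h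
    · calc (1 + |(k : ℝ)|) ^ N ≤ 2 ^ N := pow_le_pow_left₀ (by positivity) (by linarith) N
        _ ≤ 2 ^ N * (1 + |(k : ℝ)| ^ N) := le_mul_of_one_le_right (by positivity)
            (by linarith [pow_nonneg (abs_nonneg (k : ℝ)) N])
    · calc (1 + |(k : ℝ)|) ^ N ≤ (2 * |(k : ℝ)|) ^ N :=
            pow_le_pow_left₀ (by positivity) (by linarith) N
        _ = 2 ^ N * |(k : ℝ)| ^ N := mul_pow _ _ _
        _ ≤ 2 ^ N * (1 + |(k : ℝ)| ^ N) := by gcongr; linarith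
  calc (1 + |(k : ℝ)|) ^ N * A ≤ 2 ^ N * (1 + |(k : ℝ)| ^ N) * A := by gcongr
    _ = 2 ^ N * (|(k : ℝ)| ^ 0 * A + |(k : ℝ)| ^ N * A) := by ring
    _ ≤ 2 ^ N * (M₀ + M₁) := by gcongr

lemma summable_inv_sq : Summable fun k : ℤ => ((1 + |(k : ℝ)|) ^ 2)⁻¹ := by
  have h : Summable fun n : ℕ => ((1 + (n : ℝ)) ^ 2)⁻¹ := by
    have := (summable_nat_add_iff 1).2 (Real.summable_nat_pow_inv.2 (one_lt_two))
    refine this.congr fun n => ?_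
    push_cast
    rw [add_comm]
  refine Summable.of_nat_of_neg ?_ ?_ <;> simpa using h

lemma memlp_weighted (s : ℕ) (f : SmoothFun) :
    Memℓp (fun k : ℤ => (1 + |(k : ℝ)| : ℂ) ^ s * circleCoeff f.toFun k) 2 := by
  obtain ⟨M, hM, h⟩ := circleCoeff_decay f (s + 1)
  refine memℓp_gen ?_
  refine Summable.of_nonneg_of_le (fun k => by positivity) (fun k => ?_)
    (summable_inv_sq.mul_left (M ^ 2))
  have hk := h k
  have hpos : 0 < 1 + |(k : ℝ)| := by positivity
  have hn : ‖(1 + |(k : ℝ)| : ℂ) ^ s * circleCoeff f.toFun k‖ =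
      (1 + |(k : ℝ)|) ^ s * ‖circleCoeff f.toFun k‖ := by
    rw [norm_mul, norm_pow]
    congr 2
    rw [← Complex.ofReal_one, ← Complex.ofReal_add, Complex.norm_real, Real.norm_of_nonneg hpos.le]
  rw [hn, ENNReal.toReal_ofNat, Real.rpow_two, ← div_eq_mul_inv, ← div_pow]
  refine pow_le_pow_left₀ (by positivity) ?_ 2
  rw [le_div_iff₀ hpos]
  calc _ = (1 + |(k : ℝ)|) ^ (s + 1) * ‖circleCoeff f.toFun k‖ := by ring
    _ ≤ M := hk

lemma circleCoeff_add (f g : SmoothFun) (k : ℤ) :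
    circleCoeff (f + g).toFun k = circleCoeff f.toFun k + circleCoeff g.toFun k := by
  have hf := f.continuous_exp
  have hg := g.continuous_exp
  have h : ∀ t : ℝ, (f + g).toFun (Circle.exp t) =
    f.toFun (Circle.exp t) + g.toFun (Circle.exp t) := fun _ => rfl
  simp only [circleCoeff_eq, h, add_mul]
  rw [intervalIntegral.integral_add, mul_add] <;>
    exact Continuous.intervalIntegrable (by fun_prop) _ _

lemma circleCoeff_smul (c : ℂ) (f : SmoothFun) (k : ℤ) :
    circleCoeff (c • f).toFun k = c * circleCoeff f.toFun k := by
  have h : ∀ t : ℝ, (c • f).toFun (Circle.exp t) = c * f.toFun (Circle.exp t) := fun _ => rfl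
  simp only [circleCoeff_eq, h, mul_assoc, intervalIntegral.integral_const_mul]
  ring

/-- The linear map `f ↦ ((1 + |k|)^s f̂(k))_k` from `𝒟` to `ℓ²(ℤ)`. -/
def weightedCoeff (s : ℕ) : SmoothFun →ₗ[ℂ] lp (fun _ : ℤ => ℂ) 2 where
  toFun f := ⟨fun k => (1 + |(k : ℝ)| : ℂ) ^ s * circleCoeff f.toFun k, memlp_weighted s f⟩
  map_add' f g := by
    ext k
    simp only [circleCoeff_add, mul_add]
    rfl
  map_smul' c f := by
    ext k
    simp only [circleCoeff_smul, mul_left_comm _ c]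
    rfl

/-- The seminorms `‖f‖_α = (∑_k |f̂(k)|² (1 + |k|)^α)^{1/2}` of `𝒟`, for `α = 2 s`, `s ∈ ℕ`.
(`‖f‖_α` increases with `α`, so these define the same topology as the family of all `α > 0`.) -/
def smoothSeminorms : SeminormFamily ℂ SmoothFun ℕ := fun s =>
  (normSeminorm ℂ (lp (fun _ : ℤ => ℂ) 2)).comp (weightedCoeff s)

/-- The Fréchet topology of `𝒟`. -/
instance : TopologicalSpace SmoothFun := smoothSeminorms.moduleFilterBasis.topology

lemma withSeminorms_smoothSeminorms : WithSeminorms smoothSeminorms := ⟨rfl⟩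

/-- The space `𝒟'` of distributions on the circle: the topological dual of `𝒟`. -/
abbrev CircleDistribution : Type := SmoothFun →L[ℂ] ℂ

/-- The monomial `ζ ↦ ζ^k`, `k ∈ ℤ`, as an element of `𝒟`. -/
def monomialFun (k : ℤ) : SmoothFun :=
  SmoothFun.mk (fun ζ => ((ζ ^ k : Circle) : ℂ)) (by
    unfold IsSmoothOnCircle
    simp only [coe_exp_zpow]
    have h : ContDiff ℝ ∞ fun t : ℝ => (t : ℂ) := Complex.ofRealCLM.contDiff
    exact (contDiff_const.mul h).cexp)

/-- The Fourier coefficient `μ̂(k) = μ(ζ^{-k})` of a distribution. -/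
def distCoeff (μ : CircleDistribution) (k : ℤ) : ℂ := μ (monomialFun (-k))

/-- `μ` is real: it takes real values on real-valued smooth functions. -/
def IsRealDist (μ : CircleDistribution) : Prop :=
  ∀ f : SmoothFun, (∀ ζ, (f.toFun ζ).im = 0) → (μ f).im = 0

/-- `μ ≥ 0`: it takes nonnegative (real) values on nonnegative smooth functions. -/
def IsPositiveDist (μ : CircleDistribution) : Prop :=
  ∀ f : SmoothFun, (∀ ζ, 0 ≤ f.toFun ζ) → 0 ≤ μ f

/-- The Poisson kernel `P_z(ζ) = (1 - |z|²) / |ζ - z|²` of `z ∈ 𝔻`, as an element of `𝒟`. -/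
def poissonFun (z : ℂ) (hz : ‖z‖ < 1) : SmoothFun :=
  SmoothFun.mk (fun ζ => (((1 - ‖z‖ ^ 2) / ‖(ζ : ℂ) - z‖ ^ 2 : ℝ) : ℂ)) (by
    unfold IsSmoothOnCircle
    have h0 : ContDiff ℝ ∞ fun t : ℝ => (t : ℂ) := Complex.ofRealCLM.contDiff
    have h1 : ContDiff ℝ ∞ fun t : ℝ => ((Circle.exp t : Circle) : ℂ) - z := by
      simp only [Circle.coe_exp]
      exact (h0.mul contDiff_const).cexp.sub contDiff_const
    refine Complex.ofRealCLM.contDiff.comp (contDiff_const.div (h1.norm_sq ℝ) fun t ht => ?_)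
    have h2 : ((Circle.exp t : Circle) : ℂ) = z := by
      simpa [sub_eq_zero] using ht
    rw [← h2, Circle.norm_coe] at hz
    exact lt_irrefl _ hz)

/-- The Poisson extension `P_μ(z) = μ(P_z)`, `z ∈ 𝔻` (and `0` off the disc). -/
def poissonExt (μ : CircleDistribution) (z : ℂ) : ℂ :=
  if hz : ‖z‖ < 1 then μ (poissonFun z hz) else 0

/-! ## Finite measures and their derivatives -/

/-- The circle carries its Borel `σ`-algebra. -/
instance : MeasurableSpace Circle := borel Circle

instance : BorelSpace Circle := ⟨rfl⟩

/-- The Fourier coefficient `∫ ζ^{-k} dν` of a finite real measure `ν`, with Jordan decomposition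
`ν = ν⁺ - ν⁻`. -/
def signedCoeff (ν : SignedMeasure Circle) (k : ℤ) : ℂ :=
  (∫ ζ : Circle, ((ζ ^ (-k) : Circle) : ℂ) ∂ν.toJordanDecomposition.posPart) -
    ∫ ζ : Circle, ((ζ ^ (-k) : Circle) : ℂ) ∂ν.toJordanDecomposition.negPart

/-- The Fourier coefficient `∫ ζ^{-k} dν` of a finite complex measure `ν` on the circle. -/
def measureCoeff (ν : ComplexMeasure Circle) (k : ℤ) : ℂ :=
  signedCoeff (ComplexMeasure.re ν) k + Complex.I * signedCoeff (ComplexMeasure.im ν) k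

/-- `μ = ∑_{j=0}^{J} D^j ν_j` for some finite measures `ν_0, …, ν_J` on the circle, where `D` is the
operator on distributions given by `(Dμ)^(k) = |k| μ̂(k)`. Both sides are distributions, and these
are determined by their Fourier coefficients. -/
def IsSumOfDerivatives (μ : CircleDistribution) (J : ℕ) : Prop :=
  ∃ ν : ℕ → ComplexMeasure Circle, ∀ k : ℤ,
    distCoeff μ k = ∑ j ∈ Finset.range (J + 1), ((|k| : ℤ) : ℂ) ^ j * measureCoeff (ν j) k

/-! ## Weighted Dirichlet integrals and allowable tuples -/

/-- The space `𝒟_a`: `f` is analytic on the open unit disc and smooth on the closed one. -/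
def IsSmoothAnalytic (f : ℂ → ℂ) : Prop :=
  DifferentiableOn ℂ f (Metric.ball 0 1) ∧ ContDiffOn ℝ ∞ f (Metric.closedBall 0 1)

/-- The weighted Dirichlet integral `𝒟_{μ,n}(f)`, `f ∈ 𝒟_a`: for `n ≥ 1`
`lim_{r → 1⁻} 1 / (n! (n-1)! π) ∫_{r𝔻} |f^{(n)}(z)|² P_μ(z) (1 - |z|²)^{n-1} dA(z)`, and for `n = 0`
the limit of the mean of `|f|² P_μ` over the circle of radius `r`. -/
def dirichletIntegral (μ : CircleDistribution) : ℕ → (ℂ → ℂ) → ℂ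
  | 0, f => limUnder (𝓝[<] (1 : ℝ)) fun r =>
      Real.circleAverage (fun z => ((‖f z‖ ^ 2 : ℝ) : ℂ) * poissonExt μ z) 0 r
  | n + 1, f => limUnder (𝓝[<] (1 : ℝ)) fun r =>
      ((1 / ((n + 1)! * n ! * Real.pi) : ℝ) : ℂ) *
        ∫ z in Metric.ball (0 : ℂ) r,
          ((‖iteratedDeriv (n + 1) f z‖ ^ 2 : ℝ) : ℂ) * poissonExt μ z *
            (((1 - ‖z‖ ^ 2) ^ n : ℝ) : ℂ)

/-- The quadratic form `‖f‖_μ² = ∑_{n=0}^{m-1} 𝒟_{μ_n,n}(f)` of an `m`-tuple of distributions. -/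
def dirichletForm {m : ℕ} (μ : Fin m → CircleDistribution) (f : ℂ → ℂ) : ℂ :=
  ∑ n : Fin m, dirichletIntegral (μ n) n f

/-- The `m`-tuple `μ` is allowable: for some `C > 0`, all `f ∈ 𝒟_a` satisfy
`0 ≤ ‖z f‖_μ² ≤ C² ‖f‖_μ²`. (In the order of `ℂ`, `0 ≤ w` says that `w` is real and
nonnegative.) -/
def IsAllowable {m : ℕ} (μ : Fin m → CircleDistribution) : Prop :=
  ∃ C : ℝ, 0 < C ∧ ∀ f : ℂ → ℂ, IsSmoothAnalytic f →
    0 ≤ dirichletForm μ (fun z => z * f z) ∧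
      dirichletForm μ (fun z => z * f z) ≤ (C : ℂ) ^ 2 * dirichletForm μ f

end CircleDirichlet

end

noncomputable section

namespace CircleDirichlet

/-! Everything is reduced to Taylor coefficients. If `a` is the coefficient sequence of `f`, then
𝒟_{μ,n}(f) is the double series of C(min(j,k), n) a_j conj(a_k) μ̂(k - j)
(`dirichletIntegral_eq_form`). Multiplication by z shifts both indices, so it preserves k - j and
raises min(j,k) by one. Hence the order-0 form is shift invariant, and by Pascal's rule the form of
order n + 1 grows by exactly the form of order n (`form_shift_zero`, `form_shift_succ`).

Put V(f) = 𝒟_{ν,0}(f), W(f) = 𝒟_{μ_{m-1},m-1}(f) and S(f) = ∑ (1+j)^{m-1}|a_j|². The proof compares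
all other terms with V + W through S.

S is at most a multiple of V + W (`exists_tsum_one_add_pow_le`): the lower bound on the last Poisson
extension makes W dominate ∑ C(j,m-1)|a_j|², and this misses only the coefficients with j < m-1,
which V controls by repeated backward shifts.

Conversely, a form of order n whose coefficients grow like |k|^s is at most a multiple of S when s ≤
(m-3)/2 and n + s ≤ m-2 (`exists_norm_form_le`). The kernel is then dominated by the weights of S
times 1/(1+max(j,k)), which is bounded on ℓ² by a discrete Hilbert inequality. The growth hypotheses
place every μ_n with n < m-1 in this range, so their total R satisfies |R| ≤ B₂(V+W). The form of
order m-2 of μ_{m-1} is also in range, because a positive harmonic function has bounded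
coefficients; this bounds the growth of W under the shift.

The quadratic form of the tuple is CV + W + R + CW. For C ≥ B₂ + 1 it lies between V + W and
(C+1+B₂)(V+W), and V + W grows at most by a constant factor under multiplication by z. -/

/-! ### Fourier expansions of smooth functions and distributions. -/

lemma hasSum_intervalIntegral_of_bound {ι : Type*} [Countable ι] {F : ι → ℝ → ℂ} {f : ℝ → ℂ}
    {b : ι → ℝ} {x y : ℝ} (hb : Summable b) (hF : ∀ i, Continuous (F i))
    (hFb : ∀ i, ∀ t ∈ Set.uIoc x y, ‖F i t‖ ≤ b i)
    (hs : ∀ t ∈ Set.uIoc x y, HasSum (fun i => F i t) (f t)) :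
    HasSum (fun i => ∫ t in x..y, F i t) (∫ t in x..y, f t) := by
  refine intervalIntegral.hasSum_integral_of_dominated_convergence (fun i _ => b i)
    (fun i => (hF i).aestronglyMeasurable) (fun i => ?_) ?_ ?_ ?_
  · exact Eventually.of_forall fun t ht => hFb i t ht
  · exact Eventually.of_forall fun t _ => hb
  · exact intervalIntegrable_const
  · exact Eventually.of_forall fun t ht => hs t ht

lemma integral_exp_int_mul (k : ℤ) :
    ∫ t in (0 : ℝ)..2 * Real.pi, Complex.exp (k * Complex.I * t) =
      if k = 0 then ((2 * Real.pi : ℝ) : ℂ) else 0 := by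
  split_ifs with h
  · simp [h]
  · have hc : (k : ℂ) * Complex.I ≠ 0 := by simp [h]
    rw [integral_exp_mul_complex hc]
    have : Complex.exp ((k : ℂ) * Complex.I * ((2 * Real.pi : ℝ) : ℂ)) = 1 := by
      rw [← Complex.exp_int_mul_two_pi_mul_I k]
      congr 1
      push_cast
      ring
    rw [this]
    simp

lemma circleCoeff_monomialFun (j k : ℤ) :
    circleCoeff (monomialFun j).toFun k = if k = j then 1 else 0 := by
  rw [circleCoeff_eq]
  have h : ∀ t : ℝ, (monomialFun j).toFun (Circle.exp t) * Complex.exp ((-k : ℤ) * Complex.I * t) =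
      Complex.exp ((j - k : ℤ) * Complex.I * t) := by
    intro t
    have : (monomialFun j).toFun (Circle.exp t) = ((Circle.exp t ^ j : Circle) : ℂ) := rfl
    rw [this, coe_exp_zpow, ← Complex.exp_add]
    congr 1
    push_cast
    ring
  simp only [h, integral_exp_int_mul, sub_eq_zero, eq_comm (a := j)]
  split_ifs
  · rw [← Complex.ofReal_mul, inv_mul_cancel₀ Real.two_pi_pos.ne', Complex.ofReal_one]
  · simp

lemma weightedCoeff_apply (s : ℕ) (f : SmoothFun) (k : ℤ) :
    weightedCoeff s f k = (1 + |(k : ℝ)| : ℂ) ^ s * circleCoeff f.toFun k := rfl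

lemma weightedCoeff_monomialFun (s : ℕ) (k : ℤ) :
    weightedCoeff s (monomialFun k) = lp.single 2 k ((1 + |(k : ℝ)| : ℂ) ^ s) := by
  ext j
  rw [weightedCoeff_apply, circleCoeff_monomialFun, lp.single_apply]
  by_cases h : j = k
  · subst h; simp
  · simp [h]

/-- Each seminorm is the ℓ² norm of the weighted coefficients, and finite truncations converge in
ℓ². Convergence in every seminorm is convergence in 𝒟, so continuous functionals may be applied term
by term. -/
lemma hasSum_monomialFun (f : SmoothFun) :
    HasSum (fun k : ℤ => circleCoeff f.toFun k • monomialFun k) f := by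
  rw [HasSum, SummationFilter.unconditional_filter,
    withSeminorms_smoothSeminorms.tendsto_nhds]
  intro s ε hε
  have h := lp.hasSum_single (p := 2) (by simp) (weightedCoeff s f)
  rw [HasSum, SummationFilter.unconditional_filter, Metric.tendsto_nhds] at h
  filter_upwards [h ε hε] with F hF
  have h1 : weightedCoeff s (∑ k ∈ F, circleCoeff f.toFun k • monomialFun k - f) =
      ∑ k ∈ F, lp.single 2 k (weightedCoeff s f k) - weightedCoeff s f := by
    rw [map_sub, map_sum]
    congr 1
    refine Finset.sum_congr rfl fun k _ => ?_
    rw [map_smul, weightedCoeff_monomialFun, ← lp.single_smul, weightedCoeff_apply, smul_eq_mul,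
      mul_comm]
  rw [dist_eq_norm, ← h1] at hF
  exact hF

/-- A distribution is evaluated by pairing Fourier coefficients. -/
lemma hasSum_distCoeff (μ : CircleDistribution) (f : SmoothFun) :
    HasSum (fun k : ℤ => circleCoeff f.toFun k * distCoeff μ (-k)) (μ f) := by
  have h := (hasSum_monomialFun f).mapL μ
  simpa [distCoeff] using h

/-! ### Harmonic functions on the disc with coefficients of polynomial growth. -/

/-- Sequences of polynomial growth. -/
def PolyBdd (c : ℤ → ℂ) : Prop := ∃ (K : ℝ) (s : ℕ), 0 ≤ K ∧ ∀ k, ‖c k‖ ≤ K * (1 + |(k : ℝ)|) ^ s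

lemma norm_weightedCoeff_monomialFun (s : ℕ) (k : ℤ) :
    smoothSeminorms s (monomialFun k) = (1 + |(k : ℝ)|) ^ s := by
  change ‖weightedCoeff s (monomialFun k)‖ = _
  rw [weightedCoeff_monomialFun, lp.norm_single (by simp), norm_pow]
  congr 1
  rw [← Complex.ofReal_one, ← Complex.ofReal_add, Complex.norm_real,
    Real.norm_of_nonneg (by positivity)]

/-- Continuity bounds μ by finitely many seminorms, and the seminorm of index s takes the value
(1+|k|)^s on the monomial ζ^{-k}. -/
lemma polyBdd_distCoeff (μ : CircleDistribution) : PolyBdd (distCoeff μ) := by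
  obtain ⟨F, C, -, h⟩ := Seminorm.bound_of_continuous withSeminorms_smoothSeminorms
    ((normSeminorm ℂ ℂ).comp μ.toLinearMap) (by
      change Continuous fun x => ‖μ x‖
      exact μ.continuous.norm)
  refine ⟨C, F.sup id, C.2, fun k => ?_⟩
  have h1 := h (monomialFun (-k))
  change ‖distCoeff μ k‖ ≤ C * (F.sup smoothSeminorms) (monomialFun (-k)) at h1
  refine h1.trans (mul_le_mul_of_nonneg_left ?_ C.2)
  refine Seminorm.finset_sup_apply_le (by positivity) fun s hs => ?_
  rw [norm_weightedCoeff_monomialFun]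
  push_cast
  rw [abs_neg]
  exact pow_le_pow_right₀ (by linarith [abs_nonneg (k : ℝ)]) (Finset.le_sup (f := id) hs)

/-- The harmonic monomial `r^{|k|} e^{ikt}` at `z = r e^{it}`. -/
def harmonicPow (z : ℂ) (k : ℤ) : ℂ :=
  if 0 ≤ k then z ^ k.natAbs else (starRingEnd ℂ z) ^ k.natAbs

lemma harmonicPow_circleMap (r t : ℝ) (k : ℤ) :
    harmonicPow (circleMap 0 r t) k = (r : ℂ) ^ k.natAbs * Complex.exp (k * Complex.I * t) := by
  rw [harmonicPow, circleMap_zero]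
  split_ifs with h
  · rw [mul_pow, ← Complex.exp_nat_mul]
    congr 2
    have : ((k.natAbs : ℤ) : ℂ) = (k : ℂ) := by rw [Int.natAbs_of_nonneg h]
    rw [Int.cast_natCast] at this
    rw [this]; ring
  · rw [map_mul, Complex.conj_ofReal, mul_pow, ← Complex.exp_conj, ← Complex.exp_nat_mul]
    congr 2
    have : ((k.natAbs : ℤ) : ℂ) = -(k : ℂ) := by
      rw [Int.ofNat_natAbs_of_nonpos (by omega)]; simp
    rw [Int.cast_natCast] at this
    rw [this, map_mul, Complex.conj_I, Complex.conj_ofReal]; ring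

lemma norm_harmonicPow (z : ℂ) (k : ℤ) : ‖harmonicPow z k‖ = ‖z‖ ^ k.natAbs := by
  unfold harmonicPow
  split_ifs <;> simp

lemma continuous_harmonicPow (k : ℤ) : Continuous fun z => harmonicPow z k := by
  unfold harmonicPow
  split_ifs
  · fun_prop
  · exact (Complex.continuous_conj).pow _

lemma conj_harmonicPow (z : ℂ) (k : ℤ) :
    starRingEnd ℂ (harmonicPow z k) = harmonicPow z (-k) := by
  unfold harmonicPow
  rcases lt_trichotomy k 0 with h | h | h
  · simp [h.not_ge, h.le]
  · simp [h]
  · simp [h.le, h.not_ge]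

/-- The Poisson integral reproduces the holomorphic function w^n. The coefficients of the other sign
follow by conjugation, the kernel being real. -/
lemma circleCoeff_poissonFun_neg_natCast (z : ℂ) (hz : ‖z‖ < 1) (n : ℕ) :
    circleCoeff (poissonFun z hz).toFun (-(n : ℤ)) = z ^ n := by
  have hf : DiffContOnCl ℂ (fun w : ℂ => w ^ n) (Metric.ball 0 1) :=
    (differentiable_pow n).diffContOnCl
  have h := hf.circleAverage_poissonKernel_smul' (w := z) (by simpa using hz)
  rw [← h, circleCoeff_eq, Real.circleAverage_def, Complex.real_smul]
  congr 1
  refine intervalIntegral.integral_congr fun t _ => ?_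
  have h1 : (poissonFun z hz).toFun (Circle.exp t) =
    (((1 - ‖z‖ ^ 2) / ‖(Circle.exp t : ℂ) - z‖ ^ 2 : ℝ) : ℂ) := rfl
  have h2 : (Circle.exp t : ℂ) = circleMap 0 1 t := by simp [circleMap_zero]
  rw [h1, h2, Complex.real_smul]
  congr 1
  · simp
  · rw [circleMap_zero, Complex.ofReal_one, one_mul, ← Complex.exp_nat_mul]
    congr 1
    push_cast
    ring

lemma circleCoeff_conj (f : Circle → ℂ) (k : ℤ) :
    circleCoeff (fun ζ => starRingEnd ℂ (f ζ)) k = starRingEnd ℂ (circleCoeff f (-k)) := by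
  rw [circleCoeff_eq, circleCoeff_eq, map_mul, Complex.conj_ofReal,
    intervalIntegral.integral_of_le Real.two_pi_pos.le,
    intervalIntegral.integral_of_le Real.two_pi_pos.le, ← integral_conj]
  congr 2
  ext t
  rw [map_mul, ← Complex.exp_conj]
  congr 2
  simp

lemma circleCoeff_poissonFun (z : ℂ) (hz : ‖z‖ < 1) (k : ℤ) :
    circleCoeff (poissonFun z hz).toFun k = harmonicPow z (-k) := by
  have h0 : ∀ n : ℕ, circleCoeff (poissonFun z hz).toFun (-(n : ℤ)) = harmonicPow z n := by
    intro n
    rw [circleCoeff_poissonFun_neg_natCast]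
    simp [harmonicPow]
  obtain ⟨n, rfl | rfl⟩ := k.eq_nat_or_neg
  · have h1 : (poissonFun z hz).toFun = fun ζ => starRingEnd ℂ ((poissonFun z hz).toFun ζ) := by
      ext ζ
      exact (Complex.conj_ofReal _).symm
    rw [h1, circleCoeff_conj, h0, conj_harmonicPow]
  · rw [h0, neg_neg]

lemma hasSum_poissonExt (μ : CircleDistribution) {z : ℂ} (hz : ‖z‖ < 1) :
    HasSum (fun k : ℤ => distCoeff μ k * harmonicPow z k) (poissonExt μ z) := by
  have h := hasSum_distCoeff μ (poissonFun z hz)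
  rw [poissonExt, dif_pos hz, ← (Equiv.neg ℤ).hasSum_iff]
  convert h using 2 with k
  simp [circleCoeff_poissonFun, mul_comm]

/-- `U` is the harmonic function on the disc with boundary coefficients `c`. -/
structure IsHarmonicExt (U : ℂ → ℂ) (c : ℤ → ℂ) : Prop where
  polyBdd : PolyBdd c
  hasSum : ∀ z : ℂ, ‖z‖ < 1 → HasSum (fun k : ℤ => c k * harmonicPow z k) (U z)

lemma isHarmonicExt_poissonExt (μ : CircleDistribution) :
    IsHarmonicExt (poissonExt μ) (distCoeff μ) :=
  ⟨polyBdd_distCoeff μ, fun _ hz => hasSum_poissonExt μ hz⟩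

lemma summable_one_add_pow_mul_geometric (s : ℕ) {r : ℝ} (h0 : 0 ≤ r) (h1 : r < 1) :
    Summable fun n : ℕ => (1 + (n : ℝ)) ^ s * r ^ n := by
  obtain ⟨q, hq, hq1⟩ := exists_between h1
  have hq0 : 0 < q := h0.trans_lt hq
  have hq' : ‖q‖ < 1 := by rwa [Real.norm_of_nonneg hq0.le]
  have h' : Summable fun n : ℕ => (n : ℝ) ^ s * q ^ n :=
    summable_pow_mul_geometric_of_norm_lt_one s hq'
  have h : Summable fun n : ℕ => ((n + 1 : ℕ) : ℝ) ^ s * q ^ (n + 1) * q⁻¹ :=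
    (h'.comp_injective (add_left_injective 1)).mul_right q⁻¹
  refine Summable.of_nonneg_of_le (fun n => by positivity) (fun n => ?_) h
  have h2 : r ^ n ≤ q ^ n := pow_le_pow_left₀ h0 hq.le n
  calc (1 + (n : ℝ)) ^ s * r ^ n ≤ (1 + (n : ℝ)) ^ s * q ^ n :=
        mul_le_mul_of_nonneg_left h2 (by positivity)
    _ = ((n + 1 : ℕ) : ℝ) ^ s * q ^ (n + 1) * q⁻¹ := by
      rw [pow_succ q, ← mul_assoc, mul_assoc _ q, mul_inv_cancel₀ hq0.ne', mul_one]
      push_cast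
      rw [add_comm (1 : ℝ)]

lemma summable_polynomial_mul_pow_natAbs (s : ℕ) {r : ℝ} (h0 : 0 ≤ r) (h1 : r < 1) :
    Summable fun k : ℤ => (1 + |(k : ℝ)|) ^ s * r ^ k.natAbs := by
  have h := summable_one_add_pow_mul_geometric s h0 h1
  refine Summable.of_nat_of_neg ?_ ?_ <;> simpa using h

lemma IsHarmonicExt.continuousOn {U : ℂ → ℂ} {c : ℤ → ℂ} (h : IsHarmonicExt U c) :
    ContinuousOn U (Metric.ball 0 1) := by
  obtain ⟨K, s, hK, hc⟩ := h.polyBdd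
  have key : ∀ ρ : ℝ, 0 ≤ ρ → ρ < 1 → ContinuousOn U (Metric.ball 0 ρ) := by
    intro ρ h0 h1
    have : ContinuousOn (fun z => ∑' k : ℤ, c k * harmonicPow z k) (Metric.ball 0 ρ) := by
      refine continuousOn_tsum (u := fun k : ℤ => K * ((1 + |(k : ℝ)|) ^ s * ρ ^ k.natAbs))
        (fun k => (continuous_const.mul (continuous_harmonicPow k)).continuousOn)
        ((summable_polynomial_mul_pow_natAbs s h0 h1).mul_left K) fun k z hz => ?_
      rw [norm_mul, norm_harmonicPow, ← mul_assoc]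
      have hz' : ‖z‖ ≤ ρ := (mem_ball_zero_iff.1 hz).le
      gcongr
      exact hc k
    refine this.congr fun z hz => ((h.hasSum z ?_).tsum_eq).symm
    have : ‖z‖ < ρ := by simpa using hz
    linarith
  intro z hz
  have hz' : ‖z‖ < 1 := by simpa using hz
  obtain ⟨ρ, h1, h2⟩ := exists_between hz'
  refine ContinuousAt.continuousWithinAt ((key ρ ((norm_nonneg z).trans h1.le) h2).continuousAt ?_)
  exact Metric.isOpen_ball.mem_nhds (by simpa using h1)

lemma norm_exp_int_mul (k : ℤ) (t : ℝ) : ‖Complex.exp (k * Complex.I * t)‖ = 1 := by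
  have : (k : ℂ) * Complex.I * t = ((k * t : ℝ) : ℂ) * Complex.I := by
    push_cast
    ring
  rw [this, Complex.norm_exp_ofReal_mul_I]

lemma norm_circleMap_lt_one {r : ℝ} (h0 : 0 ≤ r) (h1 : r < 1) (t : ℝ) :
    ‖circleMap 0 r t‖ < 1 := by
  rwa [norm_circleMap_zero, abs_of_nonneg h0]

lemma IsHarmonicExt.continuous_circleMap {U : ℂ → ℂ} {c : ℤ → ℂ} (h : IsHarmonicExt U c)
    {r : ℝ} (h0 : 0 ≤ r) (h1 : r < 1) : Continuous fun t => U (circleMap 0 r t) :=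
  h.continuousOn.comp_continuous (_root_.continuous_circleMap 0 r)
    fun t => by simpa using norm_circleMap_lt_one h0 h1 t

/-- The Fourier coefficients of a harmonic function on circles inside the disc. -/
lemma IsHarmonicExt.integral_circleMap {U : ℂ → ℂ} {c : ℤ → ℂ} (h : IsHarmonicExt U c)
    {r : ℝ} (h0 : 0 ≤ r) (h1 : r < 1) (k : ℤ) :
    ∫ t in (0 : ℝ)..2 * Real.pi, U (circleMap 0 r t) * Complex.exp ((-k : ℤ) * Complex.I * t) =
      ((2 * Real.pi : ℝ) : ℂ) * (c k * r ^ k.natAbs) := by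
  obtain ⟨K, s, hK, hc⟩ := h.polyBdd
  have hsum := hasSum_intervalIntegral_of_bound (x := 0) (y := 2 * Real.pi)
    (b := fun l : ℤ => K * ((1 + |(l : ℝ)|) ^ s * r ^ l.natAbs))
    (F := fun l t => c l * harmonicPow (circleMap 0 r t) l *
      Complex.exp ((-k : ℤ) * Complex.I * t))
    (f := fun t => U (circleMap 0 r t) * Complex.exp ((-k : ℤ) * Complex.I * t))
    ((summable_polynomial_mul_pow_natAbs s h0 h1).mul_left K)
    (fun l => (continuous_const.mul ((continuous_harmonicPow l).comp
      (_root_.continuous_circleMap 0 r))).mul (by fun_prop))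
    (fun l t _ => by
      rw [norm_mul, norm_exp_int_mul, mul_one, norm_mul, norm_harmonicPow, norm_circleMap_zero,
        abs_of_nonneg h0, ← mul_assoc]
      gcongr
      exact hc l)
    (fun t _ => (h.hasSum _ (norm_circleMap_lt_one h0 h1 t)).mul_right _)
  refine hsum.unique ?_
  have hterm : ∀ l : ℤ, ∫ t in (0 : ℝ)..2 * Real.pi, c l * harmonicPow (circleMap 0 r t) l *
      Complex.exp ((-k : ℤ) * Complex.I * t) =
      if l = k then ((2 * Real.pi : ℝ) : ℂ) * (c k * r ^ k.natAbs) else 0 := by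
    intro l
    have : ∀ t : ℝ, c l * harmonicPow (circleMap 0 r t) l *
        Complex.exp ((-k : ℤ) * Complex.I * t) =
        c l * r ^ l.natAbs * Complex.exp ((l - k : ℤ) * Complex.I * t) := by
      intro t
      rw [harmonicPow_circleMap, mul_assoc, mul_assoc, ← Complex.exp_add, ← mul_assoc]
      congr 2
      push_cast
      ring
    simp only [this, intervalIntegral.integral_const_mul, integral_exp_int_mul, sub_eq_zero]
    split_ifs with hl
    · rw [hl]; ring
    · simp
  simp only [hterm]
  exact hasSum_ite_eq k _

/-- The coefficients of a nonnegative harmonic function are bounded. -/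
lemma IsHarmonicExt.norm_coeff_le {U : ℂ → ℂ} {c : ℤ → ℂ} (h : IsHarmonicExt U c)
    (hU : ∀ z : ℂ, ‖z‖ < 1 → 0 ≤ U z) (k : ℤ) : ‖c k‖ ≤ ‖c 0‖ := by
  -- Since U ≥ 0, the mean of |U| over the circle of radius r is the mean of U, namely c 0, and it
  -- bounds every Fourier coefficient on that circle. Letting r → 1 removes the power of r.
  have key : ∀ r : ℝ, 0 ≤ r → r < 1 → ‖c k‖ * r ^ k.natAbs ≤ ‖c 0‖ := by
    intro r h0 h1
    have hk := h.integral_circleMap h0 h1 k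
    have hz := h.integral_circleMap h0 h1 0
    have hre : ∀ t, ((‖U (circleMap 0 r t)‖ : ℝ) : ℂ) = U (circleMap 0 r t) := by
      intro t
      have := hU _ (norm_circleMap_lt_one h0 h1 t)
      rw [Complex.norm_of_nonneg' this]
    have hz' : ((∫ t in (0 : ℝ)..2 * Real.pi, ‖U (circleMap 0 r t)‖ : ℝ) : ℂ) =
        ((2 * Real.pi : ℝ) : ℂ) * c 0 := by
      rw [← intervalIntegral.integral_ofReal]
      simp only [hre]
      simpa using hz
    have h2 : ‖∫ t in (0 : ℝ)..2 * Real.pi, U (circleMap 0 r t) *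
        Complex.exp ((-k : ℤ) * Complex.I * t)‖ ≤
        ∫ t in (0 : ℝ)..2 * Real.pi, ‖U (circleMap 0 r t)‖ := by
      refine (intervalIntegral.norm_integral_le_integral_norm Real.two_pi_pos.le).trans_eq ?_
      simp only [norm_mul, norm_exp_int_mul, mul_one]
    have h3 : 0 ≤ ∫ t in (0 : ℝ)..2 * Real.pi, ‖U (circleMap 0 r t)‖ :=
      intervalIntegral.integral_nonneg Real.two_pi_pos.le fun t _ => norm_nonneg _
    have h4 := congrArg norm hz'
    rw [Complex.norm_real, Real.norm_of_nonneg h3, norm_mul, Complex.norm_real,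
      Real.norm_of_nonneg Real.two_pi_pos.le] at h4
    rw [hk, h4, norm_mul, norm_mul, Complex.norm_real, Real.norm_of_nonneg Real.two_pi_pos.le,
      norm_pow, Complex.norm_real, Real.norm_of_nonneg h0] at h2
    exact le_of_mul_le_mul_left h2 Real.two_pi_pos
  have hlim : Tendsto (fun r : ℝ => ‖c k‖ * r ^ k.natAbs) (𝓝[<] 1) (𝓝 (‖c k‖ * 1 ^ k.natAbs)) :=
    ((continuous_const.mul (continuous_pow _)).tendsto 1).mono_left nhdsWithin_le_nhds
  rw [one_pow, mul_one] at hlim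
  refine le_of_tendsto hlim ?_
  filter_upwards [Ioo_mem_nhdsLT (show (0 : ℝ) < 1 by norm_num)] with r hr
  exact key r hr.1.le hr.2

/-! ### Taylor coefficients of functions in 𝒟_a. -/

/-- The Taylor coefficients at `0` of a function in `𝒟_a`, read off on the circle. -/
def taylorCoeff (f : ℂ → ℂ) (j : ℕ) : ℂ := circleCoeff (fun ζ : Circle => f ζ) j

/-- Rapidly decreasing sequences. -/
def RapidDecay (a : ℕ → ℂ) : Prop :=
  ∀ N : ℕ, ∃ M : ℝ, 0 ≤ M ∧ ∀ j : ℕ, (1 + (j : ℝ)) ^ N * ‖a j‖ ≤ M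

lemma IsSmoothAnalytic.isSmoothOnCircle {f : ℂ → ℂ} (hf : IsSmoothAnalytic f) :
    IsSmoothOnCircle (fun ζ : Circle => f ζ) := by
  have h1 : ContDiff ℝ ∞ fun t : ℝ => ((Circle.exp t : Circle) : ℂ) := by
    simp only [Circle.coe_exp]
    exact (Complex.ofRealCLM.contDiff.mul contDiff_const).cexp
  exact hf.2.comp_contDiff h1 fun t => by simp

lemma IsSmoothAnalytic.rapidDecay {f : ℂ → ℂ} (hf : IsSmoothAnalytic f) :
    RapidDecay (taylorCoeff f) := by
  intro N
  obtain ⟨M, hM, h⟩ := circleCoeff_decay (SmoothFun.mk _ hf.isSmoothOnCircle) N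
  refine ⟨M, hM, fun j => ?_⟩
  have := h j
  rw [Int.cast_natCast, Nat.abs_cast] at this
  exact this

lemma IsSmoothAnalytic.analyticOnNhd {f : ℂ → ℂ} (hf : IsSmoothAnalytic f) :
    AnalyticOnNhd ℂ f (Metric.ball 0 1) :=
  hf.1.analyticOnNhd Metric.isOpen_ball

/-- Cauchy's formula is used on the unit circle itself, which continuity up to the boundary permits;
its coefficients are then Fourier coefficients of the boundary values, whose decay is known. -/
lemma cauchyPowerSeries_apply_one (f : ℂ → ℂ) (n : ℕ) :
    (cauchyPowerSeries f 0 1 n fun _ => 1) = taylorCoeff f n := by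
  rw [cauchyPowerSeries_apply, taylorCoeff, circleCoeff_eq, circleIntegral, smul_eq_mul,
    ← intervalIntegral.integral_const_mul, ← intervalIntegral.integral_const_mul]
  refine intervalIntegral.integral_congr fun t _ => ?_
  have h : circleMap 0 1 t ≠ 0 := circleMap_ne_center one_ne_zero
  have h1 : (Circle.exp t : ℂ) = circleMap 0 1 t := by simp [circleMap_zero]
  have h2 : Complex.exp ((-(n : ℤ) : ℤ) * Complex.I * t) = (circleMap 0 1 t ^ n)⁻¹ := by
    rw [circleMap_zero, Complex.ofReal_one, one_mul, ← Complex.exp_nat_mul, ← Complex.exp_neg]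
    congr 1
    push_cast
    ring
  have hpi : (Real.pi : ℂ) ≠ 0 := by exact_mod_cast Real.pi_ne_zero
  simp only [deriv_circleMap, sub_zero, smul_eq_mul, h1, h2]
  have hI := Complex.I_ne_zero
  push_cast
  field_simp
  rw [one_div, inv_pow]
  field_simp

lemma IsSmoothAnalytic.iteratedDeriv_zero {f : ℂ → ℂ} (hf : IsSmoothAnalytic f) (n : ℕ) :
    iteratedDeriv n f 0 = (n ! : ℂ) * taylorCoeff f n := by
  have h := Complex.hasFPowerSeriesOnBall_of_differentiable_off_countable (c := 0) (R := 1)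
    Set.countable_empty hf.2.continuousOn (fun z hz => hf.1.differentiableAt
      (Metric.isOpen_ball.mem_nhds hz.1)) one_pos
  have h2 := h.factorial_smul (1 : ℂ) n
  rw [iteratedDeriv_eq_iteratedFDeriv, ← h2, NNReal.coe_one, cauchyPowerSeries_apply_one,
    nsmul_eq_mul]

lemma IsSmoothAnalytic.hasSum_iteratedDeriv {f : ℂ → ℂ} (hf : IsSmoothAnalytic f) (n : ℕ)
    {z : ℂ} (hz : ‖z‖ < 1) :
    HasSum (fun j : ℕ => ((j + 1).ascFactorial n : ℂ) * taylorCoeff f (j + n) * z ^ j)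
      (iteratedDeriv n f z) := by
  have hd : DifferentiableOn ℂ (iteratedDeriv n f) (Metric.ball 0 1) := by
    rw [iteratedDeriv_eq_iterate]
    exact (hf.analyticOnNhd.iterated_deriv n).differentiableOn
  have h := Complex.hasSum_taylorSeries_on_ball hd (z := z) (by simpa using hz)
  refine h.congr_fun fun j => ?_
  have h1 : iteratedDeriv j (iteratedDeriv n f) 0 = iteratedDeriv (j + n) f 0 := by
    simp only [iteratedDeriv_eq_iterate, Function.iterate_add_apply]
  have h2 : ((j + n)! : ℂ) = (j ! : ℂ) * ((j + 1).ascFactorial n : ℂ) := by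
    exact_mod_cast (Nat.factorial_mul_ascFactorial j n).symm
  have h3 : (j ! : ℂ) ≠ 0 := by exact_mod_cast j.factorial_ne_zero
  rw [h1, hf.iteratedDeriv_zero, h2, sub_zero, smul_eq_mul, smul_eq_mul]
  field_simp

lemma isSmoothAnalytic_const (c : ℂ) : IsSmoothAnalytic fun _ => c :=
  ⟨differentiableOn_const c, contDiffOn_const⟩

lemma IsSmoothAnalytic.add {f g : ℂ → ℂ} (hf : IsSmoothAnalytic f) (hg : IsSmoothAnalytic g) :
    IsSmoothAnalytic fun z => f z + g z :=
  ⟨hf.1.add hg.1, hf.2.add hg.2⟩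

lemma IsSmoothAnalytic.id_mul {f : ℂ → ℂ} (hf : IsSmoothAnalytic f) :
    IsSmoothAnalytic fun z => z * f z :=
  ⟨differentiableOn_id.mul hf.1, contDiffOn_id.mul hf.2⟩

lemma IsSmoothAnalytic.taylorCoeff_zero {f : ℂ → ℂ} (hf : IsSmoothAnalytic f) :
    taylorCoeff f 0 = f 0 := by
  have := hf.iteratedDeriv_zero 0
  simpa using this.symm

lemma taylorCoeff_id_mul_succ (f : ℂ → ℂ) (j : ℕ) :
    taylorCoeff (fun z => z * f z) (j + 1) = taylorCoeff f j := by
  rw [taylorCoeff, taylorCoeff, circleCoeff_eq, circleCoeff_eq]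
  congr 2
  ext t
  rw [mul_comm (Circle.exp t : ℂ), mul_assoc, Circle.coe_exp, ← Complex.exp_add]
  congr 2
  push_cast
  ring

lemma IsSmoothAnalytic.taylorCoeff_id_mul_zero {f : ℂ → ℂ} (hf : IsSmoothAnalytic f) :
    taylorCoeff (fun z => z * f z) 0 = 0 := by
  rw [hf.id_mul.taylorCoeff_zero, zero_mul]

lemma taylorCoeff_const (c : ℂ) (j : ℕ) :
    taylorCoeff (fun _ => c) j = if j = 0 then c else 0 := by
  have h : ∀ t : ℝ, (monomialFun 0).toFun (Circle.exp t) = 1 := fun t => by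
    simp [monomialFun, SmoothFun.mk, SmoothFun.toFun]
  have h1 := circleCoeff_monomialFun 0 j
  rw [circleCoeff_eq] at h1
  simp only [h, one_mul] at h1
  rw [taylorCoeff, circleCoeff_eq, intervalIntegral.integral_const_mul, mul_left_comm, h1]
  simp

lemma IsSmoothAnalytic.taylorCoeff_add {f g : ℂ → ℂ} (hf : IsSmoothAnalytic f)
    (hg : IsSmoothAnalytic g) (j : ℕ) :
    taylorCoeff (fun z => f z + g z) j = taylorCoeff f j + taylorCoeff g j :=
  circleCoeff_add (SmoothFun.mk _ hf.isSmoothOnCircle) (SmoothFun.mk _ hg.isSmoothOnCircle) j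

/-- The backward shift preserves `𝒟_a`. -/
lemma IsSmoothAnalytic.exists_backwardShift {f : ℂ → ℂ} (hf : IsSmoothAnalytic f) :
    ∃ g : ℂ → ℂ, IsSmoothAnalytic g ∧ f = fun z => f 0 + z * g z := by
  have hd : DifferentiableOn ℂ (dslope f 0) (Metric.ball 0 1) :=
    (Complex.differentiableOn_dslope (Metric.ball_mem_nhds 0 one_pos)).2 hf.1
  refine ⟨dslope f 0, ⟨hd, fun z hz => ?_⟩, ?_⟩
  -- At 0 smoothness comes from the removable singularity; elsewhere, including the boundary circle,
  -- from the quotient (f w - f 0) / w.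
  · by_cases h : z = 0
    · subst h
      have h1 : ContDiffAt ℂ ∞ (dslope f 0) 0 :=
        (hd.analyticOnNhd Metric.isOpen_ball 0 (Metric.mem_ball_self one_pos)).contDiffAt
      exact (h1.restrict_scalars ℝ).contDiffWithinAt
    · have h1 : ContDiffWithinAt ℝ ∞ (fun w => (f w - f 0) / w) (Metric.closedBall 0 1) z :=
        by
        simp only [div_eq_mul_inv]
        exact ((hf.2 z hz).sub contDiffWithinAt_const).mul (contDiffWithinAt_id.inv h)
      refine h1.congr_of_eventuallyEq ?_ ?_
      · have : ∀ᶠ w in 𝓝 z, w ≠ 0 := isOpen_ne.mem_nhds h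
        filter_upwards [nhdsWithin_le_nhds this] with w hw
        rw [dslope_of_ne _ hw, slope_def_field, sub_zero]
      · rw [dslope_of_ne _ h, slope_def_field, sub_zero]
  · ext z
    have := sub_smul_dslope f 0 z
    rw [sub_zero, smul_eq_mul] at this
    rw [this]
    ring

lemma RapidDecay.summable_pow_mul_norm {a : ℕ → ℂ} (ha : RapidDecay a) (s : ℕ) :
    Summable fun j : ℕ => (1 + (j : ℝ)) ^ s * ‖a j‖ := by
  obtain ⟨M, hM, h⟩ := ha (s + 2)
  have h2 : Summable fun j : ℕ => ((1 + (j : ℝ)) ^ 2)⁻¹ := by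
    have := summable_inv_sq.comp_injective (Nat.cast_injective (R := ℤ))
    simpa [Function.comp_def] using this
  refine Summable.of_nonneg_of_le (fun j => by positivity) (fun j => ?_) (h2.mul_left M)
  have := h j
  rw [← div_eq_mul_inv, le_div_iff₀ (by positivity)]
  calc _ = (1 + (j : ℝ)) ^ (s + 2) * ‖a j‖ := by ring
    _ ≤ M := this

lemma RapidDecay.summable_norm {a : ℕ → ℂ} (ha : RapidDecay a) : Summable fun j => ‖a j‖ := by
  simpa using ha.summable_pow_mul_norm 0

/-- Separates the variables, so that the polynomial growth of c(k - j) is absorbed by the rapid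
decay of a_j and a_k. -/
lemma one_add_abs_sub_le (j k : ℕ) :
    1 + |(((k : ℤ) - j : ℤ) : ℝ)| ≤ (1 + (j : ℝ)) * (1 + k) := by
  have h1 : |(((k : ℤ) - j : ℤ) : ℝ)| ≤ (k : ℝ) + j := by
    push_cast
    have hj : (0 : ℝ) ≤ j := by positivity
    have hk : (0 : ℝ) ≤ k := by positivity
    rw [abs_le]
    constructor <;> linarith
  have : (0 : ℝ) ≤ (j : ℝ) * k := by positivity
  nlinarith

/-! ### The double series of a form, and circle averages. -/

/-- The terms of the double series of a weighted Dirichlet integral. -/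
def formTerm (c : ℤ → ℂ) (n : ℕ) (a : ℕ → ℂ) (p : ℕ × ℕ) : ℂ :=
  ((min p.1 p.2).choose n : ℂ) * (a p.1 * starRingEnd ℂ (a p.2) * c (p.2 - p.1))

/-- The weighted Dirichlet integral in terms of coefficients. -/
def form (c : ℤ → ℂ) (n : ℕ) (a : ℕ → ℂ) : ℂ := ∑' p, formTerm c n a p

lemma summable_norm_mul_coeff {c : ℤ → ℂ} (hc : PolyBdd c) {a : ℕ → ℂ} (ha : RapidDecay a)
    (n : ℕ) : Summable fun p : ℕ × ℕ => (1 + (p.1 : ℝ)) ^ n * (1 + (p.2 : ℝ)) ^ n *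
      ‖a p.1 * starRingEnd ℂ (a p.2) * c (p.2 - p.1)‖ := by
  obtain ⟨K, s, hK, h⟩ := hc
  have hs := ha.summable_pow_mul_norm (n + s)
  have h2 := (hs.mul_of_nonneg hs (fun _ => by positivity) (fun _ => by positivity)).mul_left K
  refine Summable.of_nonneg_of_le (fun p => by positivity) (fun p => ?_) h2
  rw [norm_mul, norm_mul, RCLike.norm_conj]
  have h3 : ‖c (p.2 - p.1)‖ ≤ K * ((1 + (p.1 : ℝ)) * (1 + p.2)) ^ s :=
    (h _).trans (by gcongr; exact one_add_abs_sub_le p.1 p.2)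
  calc (1 + (p.1 : ℝ)) ^ n * (1 + (p.2 : ℝ)) ^ n * (‖a p.1‖ * ‖a p.2‖ * ‖c (p.2 - p.1)‖)
      ≤ (1 + (p.1 : ℝ)) ^ n * (1 + (p.2 : ℝ)) ^ n * (‖a p.1‖ * ‖a p.2‖ *
        (K * ((1 + (p.1 : ℝ)) * (1 + p.2)) ^ s)) := by gcongr
    _ = _ := by rw [mul_pow]; ring

lemma summable_norm_mul_coeff_zero {c : ℤ → ℂ} (hc : PolyBdd c) {a : ℕ → ℂ} (ha : RapidDecay a) :
    Summable fun p : ℕ × ℕ => ‖a p.1 * starRingEnd ℂ (a p.2) * c (p.2 - p.1)‖ := by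
  simpa using summable_norm_mul_coeff hc ha 0

lemma choose_min_le (j k n : ℕ) :
    (((min j k).choose n : ℕ) : ℝ) ≤ (1 + (j : ℝ)) ^ n * (1 + (k : ℝ)) ^ n := by
  have h1 : (((min j k).choose n : ℕ) : ℝ) ≤ ((min j k : ℕ) : ℝ) ^ n := by
    exact_mod_cast Nat.choose_le_pow _ _
  have h2 : ((min j k : ℕ) : ℝ) ≤ j := by exact_mod_cast min_le_left j k
  have hk : (1 : ℝ) ≤ (1 + (k : ℝ)) ^ n := one_le_pow₀ (by simp)
  calc _ ≤ ((min j k : ℕ) : ℝ) ^ n := h1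
    _ ≤ (1 + (j : ℝ)) ^ n := by gcongr; linarith
    _ ≤ _ := le_mul_of_one_le_right (by positivity) hk

lemma summable_formTerm {c : ℤ → ℂ} (hc : PolyBdd c) {a : ℕ → ℂ} (ha : RapidDecay a) (n : ℕ) :
    Summable (formTerm c n a) := by
  refine Summable.of_norm_bounded (summable_norm_mul_coeff hc ha n) fun p => ?_
  rw [formTerm, norm_mul, Complex.norm_natCast]
  exact mul_le_mul_of_nonneg_right (choose_min_le _ _ _) (norm_nonneg _)

lemma hasSum_mul_conj_powerSeries {a : ℕ → ℂ} (ha : RapidDecay a) {z w : ℂ} (hz : ‖z‖ ≤ 1)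
    (h : HasSum (fun j : ℕ => a j * z ^ j) w) :
    HasSum (fun p : ℕ × ℕ => a p.1 * z ^ p.1 * starRingEnd ℂ (a p.2 * z ^ p.2))
      ((‖w‖ ^ 2 : ℝ) : ℂ) := by
  have h' : HasSum (fun j : ℕ => starRingEnd ℂ (a j * z ^ j)) (starRingEnd ℂ w) :=
    Complex.hasSum_conj'.2 h
  have hn : Summable fun j : ℕ => ‖a j * z ^ j‖ := by
    refine Summable.of_nonneg_of_le (fun _ => norm_nonneg _) (fun j => ?_) ha.summable_norm
    rw [norm_mul, norm_pow]
    exact mul_le_of_le_one_right (norm_nonneg _) (pow_le_one₀ (norm_nonneg _) hz)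
  have hn' : Summable fun j : ℕ => ‖starRingEnd ℂ (a j * z ^ j)‖ := by
    simpa only [RCLike.norm_conj] using hn
  have hp : Summable fun p : ℕ × ℕ => a p.1 * z ^ p.1 * starRingEnd ℂ (a p.2 * z ^ p.2) :=
    summable_mul_of_summable_norm (f := fun j : ℕ => a j * z ^ j)
      (g := fun j : ℕ => starRingEnd ℂ (a j * z ^ j)) hn hn'
  have hm := HasSum.mul h h' hp
  rwa [Complex.mul_conj', ← Complex.ofReal_pow] at hm

/-- Expand |F|² as a double power series: on the circle the (j,k) term has frequency j - k, so
integration against U picks out the coefficient c(k - j). -/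
lemma IsHarmonicExt.hasSum_circleAverage {U : ℂ → ℂ} {c : ℤ → ℂ} (h : IsHarmonicExt U c)
    {F : ℂ → ℂ} {a : ℕ → ℂ} (ha : RapidDecay a)
    (hF : ∀ z : ℂ, ‖z‖ < 1 → HasSum (fun j : ℕ => a j * z ^ j) (F z))
    {r : ℝ} (h0 : 0 ≤ r) (h1 : r < 1) :
    HasSum (fun p : ℕ × ℕ => a p.1 * starRingEnd ℂ (a p.2) * c (p.2 - p.1) *
        (r : ℂ) ^ (2 * max p.1 p.2))
      (Real.circleAverage (fun z => ((‖F z‖ ^ 2 : ℝ) : ℂ) * U z) 0 r) := by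
  have hUc := h.continuous_circleMap h0 h1
  obtain ⟨B, hB⟩ := (isCompact_uIcc (a := (0 : ℝ)) (b := 2 * Real.pi)).exists_bound_of_continuousOn
    hUc.continuousOn
  set T : ℕ × ℕ → ℝ → ℂ := fun p t => a p.1 * circleMap 0 r t ^ p.1 *
    starRingEnd ℂ (a p.2 * circleMap 0 r t ^ p.2) * U (circleMap 0 r t) with hT
  have hb : Summable fun p : ℕ × ℕ => ‖a p.1‖ * ‖a p.2‖ * B :=
    (ha.summable_norm.mul_of_nonneg ha.summable_norm (fun _ => norm_nonneg _)
      (fun _ => norm_nonneg _)).mul_right B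
  have hTc : ∀ p, Continuous (T p) := fun p => by
    have h3 := _root_.continuous_circleMap 0 r
    have h4 := Complex.continuous_conj
    exact ((continuous_const.mul (h3.pow _)).mul (h4.comp (continuous_const.mul (h3.pow _)))).mul
      hUc
  have hTb : ∀ p, ∀ t ∈ Set.uIoc 0 (2 * Real.pi), ‖T p t‖ ≤ ‖a p.1‖ * ‖a p.2‖ * B := by
    intro p t ht
    have hz := norm_circleMap_lt_one h0 h1 t
    have e1 : ‖circleMap 0 r t‖ ^ p.1 ≤ 1 := pow_le_one₀ (norm_nonneg _) hz.le
    have e2 : ‖circleMap 0 r t‖ ^ p.2 ≤ 1 := pow_le_one₀ (norm_nonneg _) hz.le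
    have e3 := hB t (Set.uIoc_subset_uIcc ht)
    have e4 := mul_le_of_le_one_right (norm_nonneg (a p.1)) e1
    have e5 := mul_le_of_le_one_right (norm_nonneg (a p.2)) e2
    rw [hT, norm_mul, norm_mul, RCLike.norm_conj, norm_mul, norm_mul, norm_pow, norm_pow]
    exact mul_le_mul (mul_le_mul e4 e5 (by positivity) (norm_nonneg _)) e3 (norm_nonneg _)
      (by positivity)
  have hTs : ∀ t ∈ Set.uIoc 0 (2 * Real.pi), HasSum (fun p => T p t)
      (((‖F (circleMap 0 r t)‖ ^ 2 : ℝ) : ℂ) * U (circleMap 0 r t)) := by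
    intro t _
    have hz := norm_circleMap_lt_one h0 h1 t
    refine HasSum.mul_right _ ?_
    exact hasSum_mul_conj_powerSeries ha hz.le (hF _ hz)
  have hsum := hasSum_intervalIntegral_of_bound hb hTc hTb hTs
  rw [Real.circleAverage_def]
  have hsum' := hsum.mul_left (((2 * Real.pi)⁻¹ : ℝ) : ℂ)
  rw [Complex.real_smul]
  refine hsum'.congr_fun fun p => ?_
  have hterm : ∀ t : ℝ, T p t =
      a p.1 * starRingEnd ℂ (a p.2) * r ^ (p.1 + p.2) * (U (circleMap 0 r t) *
        Complex.exp ((-((p.2 : ℤ) - p.1) : ℤ) * Complex.I * t)) := by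
    intro t
    simp only [hT]
    rw [map_mul, map_pow, circleMap_zero, map_mul, Complex.conj_ofReal, ← Complex.exp_conj,
      mul_pow, mul_pow, ← Complex.exp_nat_mul, ← Complex.exp_nat_mul]
    have : Complex.exp ((-((p.2 : ℤ) - p.1) : ℤ) * Complex.I * t) =
        Complex.exp (p.1 * (t * Complex.I)) *
          Complex.exp (p.2 * (starRingEnd ℂ (t * Complex.I))) := by
      rw [← Complex.exp_add, map_mul, Complex.conj_I, Complex.conj_ofReal]
      congr 1
      push_cast
      ring
    rw [this, pow_add]
    ring
  simp only [hterm]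
  rw [intervalIntegral.integral_const_mul, h.integral_circleMap h0 h1]
  -- The powers of r combine by j + k + |k - j| = 2 max(j,k).
  have hpow : (r : ℂ) ^ (2 * max p.1 p.2) =
      r ^ (p.1 + p.2) * r ^ ((p.2 : ℤ) - p.1).natAbs := by
    rw [← pow_add]
    congr 1
    omega
  have hpi : ((2 * Real.pi : ℝ) : ℂ) ≠ 0 := by exact_mod_cast Real.two_pi_pos.ne'
  rw [hpow, Complex.ofReal_inv]
  field_simp

/-! ### Area integrals in polar coordinates and the limit r → 1. -/

lemma circleMap_eq_polarCoord_symm (r t : ℝ) :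
    Complex.polarCoord.symm (r, t) = circleMap 0 r t := by
  rw [Complex.polarCoord_symm_apply, circleMap_zero, Complex.exp_mul_I, Complex.ofReal_cos,
    Complex.ofReal_sin]

lemma integral_circleMap_eq_circleAverage (h : ℂ → ℂ) (r : ℝ) :
    ∫ t in Set.Ioo (-Real.pi) Real.pi, h (circleMap 0 r t) =
      ((2 * Real.pi : ℝ) : ℂ) * Real.circleAverage h 0 r := by
  rw [Real.circleAverage_eq_integral_add (-Real.pi),
    intervalIntegral.integral_comp_add_right (fun θ => h (circleMap 0 r θ)), Complex.real_smul,
    ← mul_assoc, ← Complex.ofReal_mul, mul_inv_cancel₀ Real.two_pi_pos.ne', Complex.ofReal_one,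
    one_mul, ← integral_Ioc_eq_integral_Ioo, ← intervalIntegral.integral_of_le
    (by linarith [Real.pi_pos])]
  congr 1 <;> ring

/-- Integration over a disc in polar coordinates. -/
lemma integral_ball_eq_integral_circleAverage {h : ℂ → ℂ}
    (hc : ContinuousOn h (Metric.ball 0 1)) {ρ : ℝ} (h0 : 0 < ρ) (h1 : ρ < 1) :
    ∫ z in Metric.ball (0 : ℂ) ρ, h z =
      ∫ r in (0 : ℝ)..ρ, ((2 * Real.pi * r : ℝ) : ℂ) * Real.circleAverage h 0 r := by
  rw [← integral_indicator measurableSet_ball, ← Complex.integral_comp_polarCoord_symm,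
    polarCoord_target]
  have hI : IntegrableOn (fun p : ℝ × ℝ => (p.1 : ℂ) * h (circleMap 0 p.1 p.2))
      (Set.Ioo 0 ρ ×ˢ Set.Ioo (-Real.pi) Real.pi) (volume.prod volume) := by
    have hK : IsCompact (Set.Icc (0 : ℝ) ρ ×ˢ Set.Icc (-Real.pi) Real.pi) :=
      isCompact_Icc.prod isCompact_Icc
    have hcont : ContinuousOn (fun p : ℝ × ℝ => (p.1 : ℂ) * h (circleMap 0 p.1 p.2))
        (Set.Icc (0 : ℝ) ρ ×ˢ Set.Icc (-Real.pi) Real.pi) := by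
      refine ContinuousOn.mul (by fun_prop) (hc.comp ?_ ?_)
      · simp only [circleMap_zero]
        fun_prop
      · rintro ⟨r, t⟩ ⟨hr, -⟩
        simpa using norm_circleMap_lt_one hr.1 (hr.2.trans_lt h1) t
    exact (hcont.integrableOn_compact hK).mono_set
      (Set.prod_mono Set.Ioo_subset_Icc_self Set.Ioo_subset_Icc_self)
  have e1 : ∫ p in Set.Ioi (0 : ℝ) ×ˢ Set.Ioo (-Real.pi) Real.pi,
      p.1 • (Metric.ball (0 : ℂ) ρ).indicator h (Complex.polarCoord.symm p) =
      ∫ p in Set.Ioo (0 : ℝ) ρ ×ˢ Set.Ioo (-Real.pi) Real.pi,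
        (p.1 : ℂ) * h (circleMap 0 p.1 p.2) := by
    have hms : MeasurableSet (Set.Ioo (0 : ℝ) ρ ×ˢ Set.Ioo (-Real.pi) Real.pi) :=
      measurableSet_Ioo.prod measurableSet_Ioo
    rw [← integral_indicator (measurableSet_Ioi.prod measurableSet_Ioo),
      ← integral_indicator hms]
    congr 1
    ext ⟨r, t⟩
    by_cases hr : 0 < r
    · by_cases ht : t ∈ Set.Ioo (-Real.pi) Real.pi
      · by_cases hρ : r < ρ
        · rw [Set.indicator_of_mem (Set.mk_mem_prod (Set.mem_Ioi.2 hr) ht),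
            Set.indicator_of_mem (Set.mk_mem_prod (Set.mem_Ioo.2 ⟨hr, hρ⟩) ht),
            circleMap_eq_polarCoord_symm, Set.indicator_of_mem, Complex.real_smul]
          simpa [abs_of_pos hr] using hρ
        · have hball : circleMap 0 r t ∉ Metric.ball (0 : ℂ) ρ := by
            simpa [abs_of_pos hr] using hρ
          have hprod : (r, t) ∉ Set.Ioo (0 : ℝ) ρ ×ˢ Set.Ioo (-Real.pi) Real.pi :=
            fun h => hρ h.1.2
          rw [Set.indicator_of_mem (Set.mk_mem_prod (Set.mem_Ioi.2 hr) ht),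
            Set.indicator_of_notMem hprod, circleMap_eq_polarCoord_symm,
            Set.indicator_of_notMem hball, smul_zero]
      · rw [Set.indicator_of_notMem (fun h => ht h.2), Set.indicator_of_notMem (fun h => ht h.2)]
    · rw [Set.indicator_of_notMem (fun h => hr h.1), Set.indicator_of_notMem (fun h => hr h.1.1)]
  rw [e1, Measure.volume_eq_prod, setIntegral_prod _ hI, intervalIntegral.integral_of_le h0.le,
    integral_Ioc_eq_integral_Ioo]
  refine setIntegral_congr_fun measurableSet_Ioo fun r _ => ?_
  simp only
  rw [integral_const_mul, integral_circleMap_eq_circleAverage]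
  push_cast
  ring

/-- A Beta integral in the variable r². Splitting off one factor 1 - r² expresses exponent n + 1
through exponent n at M and M + 1. -/
lemma integral_pow_mul_one_sub_sq (n : ℕ) : ∀ M : ℕ,
    ∫ r in (0 : ℝ)..1, 2 * r ^ (2 * M + 1) * (1 - r ^ 2) ^ n =
      (M ! : ℝ) * n ! / (M + n + 1)! := by
  induction n with
  | zero =>
    intro M
    simp only [pow_zero, mul_one, intervalIntegral.integral_const_mul, integral_pow,
      Nat.factorial_zero, Nat.cast_one, add_zero, Nat.factorial_succ]
    have : (M ! : ℝ) ≠ 0 := by exact_mod_cast M.factorial_ne_zero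
    rw [one_pow, zero_pow (by omega), sub_zero]
    push_cast
    field_simp
    ring
  | succ n ih =>
    intro M
    have e : ∀ r : ℝ, 2 * r ^ (2 * M + 1) * (1 - r ^ 2) ^ (n + 1) =
        2 * r ^ (2 * M + 1) * (1 - r ^ 2) ^ n -
          2 * r ^ (2 * (M + 1) + 1) * (1 - r ^ 2) ^ n := by
      intro r; ring
    simp only [e]
    rw [intervalIntegral.integral_sub (Continuous.intervalIntegrable (by fun_prop) _ _)
      (Continuous.intervalIntegrable (by fun_prop) _ _), ih, ih]
    have h1 : (M + 1 + n + 1)! = (M + n + 2) * (M + n + 1)! := by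
      rw [show M + 1 + n + 1 = (M + n + 1) + 1 by ring, Nat.factorial_succ]
    have h2 : (M + (n + 1) + 1)! = (M + n + 2) * (M + n + 1)! := by
      rw [show M + (n + 1) + 1 = (M + n + 1) + 1 by ring, Nat.factorial_succ]
    rw [h1, h2, Nat.factorial_succ n, Nat.factorial_succ M]
    have : ((M + n + 1)! : ℝ) ≠ 0 := by exact_mod_cast Nat.factorial_ne_zero _
    have h3 : (M : ℝ) + n + 2 ≠ 0 := by positivity
    push_cast
    field_simp
    ring

lemma IsHarmonicExt.tendsto_circleAverage {U : ℂ → ℂ} {c : ℤ → ℂ} (h : IsHarmonicExt U c)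
    {F : ℂ → ℂ} {a : ℕ → ℂ} (ha : RapidDecay a)
    (hF : ∀ z : ℂ, ‖z‖ < 1 → HasSum (fun j : ℕ => a j * z ^ j) (F z)) :
    Tendsto (fun r => Real.circleAverage (fun z => ((‖F z‖ ^ 2 : ℝ) : ℂ) * U z) 0 r)
      (𝓝[<] 1) (𝓝 (∑' p : ℕ × ℕ, a p.1 * starRingEnd ℂ (a p.2) * c (p.2 - p.1))) := by
  have hmem : Set.Ioo (0 : ℝ) 1 ∈ 𝓝[<] (1 : ℝ) := Ioo_mem_nhdsLT one_pos
  have hlim := tendsto_tsum_of_dominated_convergence (𝓕 := 𝓝[<] (1 : ℝ))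
    (f := fun (r : ℝ) (p : ℕ × ℕ) => a p.1 * starRingEnd ℂ (a p.2) * c (p.2 - p.1) *
        (r : ℂ) ^ (2 * max p.1 p.2))
    (g := fun p => a p.1 * starRingEnd ℂ (a p.2) * c (p.2 - p.1))
    (summable_norm_mul_coeff_zero h.polyBdd ha) ?_ ?_
  · refine hlim.congr' ?_
    filter_upwards [hmem] with r hr
    exact (h.hasSum_circleAverage ha hF hr.1.le hr.2).tsum_eq
  · intro p
    have : Continuous fun r : ℝ => a p.1 * starRingEnd ℂ (a p.2) * c (p.2 - p.1) *
        (r : ℂ) ^ (2 * max p.1 p.2) := by fun_prop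
    have := (this.tendsto 1).mono_left (nhdsWithin_le_nhds (s := Set.Iio 1))
    simpa using this
  · filter_upwards [hmem] with r hr p
    rw [norm_mul, norm_pow, Complex.norm_real, Real.norm_of_nonneg hr.1.le]
    exact mul_le_of_le_one_right (norm_nonneg _) (pow_le_one₀ hr.1.le hr.2.le)

lemma IsHarmonicExt.tendsto_integral_ball {U : ℂ → ℂ} {c : ℤ → ℂ} (h : IsHarmonicExt U c)
    {F : ℂ → ℂ} {a : ℕ → ℂ} (ha : RapidDecay a)
    (hF : ∀ z : ℂ, ‖z‖ < 1 → HasSum (fun j : ℕ => a j * z ^ j) (F z))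
    (hFc : ContinuousOn F (Metric.ball 0 1)) (n : ℕ) :
    Tendsto (fun ρ : ℝ => ∫ z in Metric.ball (0 : ℂ) ρ,
        ((‖F z‖ ^ 2 : ℝ) : ℂ) * U z * (((1 - ‖z‖ ^ 2) ^ n : ℝ) : ℂ))
      (𝓝[<] 1) (𝓝 (∑' p : ℕ × ℕ, a p.1 * starRingEnd ℂ (a p.2) * c (p.2 - p.1) *
        ((Real.pi * (((max p.1 p.2)! : ℝ) * n ! / (max p.1 p.2 + n + 1)!) : ℝ) : ℂ))) := by
  have hmem : Set.Ioo (0 : ℝ) 1 ∈ 𝓝[<] (1 : ℝ) := Ioo_mem_nhdsLT one_pos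
  set I : ℝ → ℕ → ℝ := fun ρ M => ∫ r in (0 : ℝ)..ρ, 2 * r ^ (2 * M + 1) * (1 - r ^ 2) ^ n with hI
  -- A bound uniform in ρ and M, needed for dominated convergence of the double series.
  have hIb : ∀ ρ ∈ Set.Ioo (0 : ℝ) 1, ∀ M, |I ρ M| ≤ 2 := by
    intro ρ hρ M
    have := intervalIntegral.norm_integral_le_of_norm_le_const (a := 0) (b := ρ) (C := 2)
      (f := fun r : ℝ => 2 * r ^ (2 * M + 1) * (1 - r ^ 2) ^ n) (fun r hr => by
        rw [Set.uIoc_of_le hρ.1.le] at hr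
        have hr1 : r ≤ 1 := hr.2.trans hρ.2.le
        have hsq : r ^ 2 ≤ 1 := pow_le_one₀ hr.1.le hr1
        rw [Real.norm_of_nonneg (mul_nonneg (by have := hr.1; positivity)
          (pow_nonneg (by linarith) _))]
        have e1 : r ^ (2 * M + 1) ≤ 1 := pow_le_one₀ hr.1.le hr1
        have e2 : (1 - r ^ 2) ^ n ≤ 1 := pow_le_one₀ (by linarith) (by linarith [sq_nonneg r])
        have e3 : 0 ≤ (1 - r ^ 2) ^ n := pow_nonneg (by linarith) _
        nlinarith [pow_nonneg hr.1.le (2 * M + 1)])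
    rw [Real.norm_eq_abs, sub_zero, abs_of_pos hρ.1] at this
    linarith [hρ.2]
  have hlim := tendsto_tsum_of_dominated_convergence (𝓕 := 𝓝[<] (1 : ℝ))
    (f := fun (ρ : ℝ) (p : ℕ × ℕ) => a p.1 * starRingEnd ℂ (a p.2) * c (p.2 - p.1) *
        ((Real.pi * I ρ (max p.1 p.2) : ℝ) : ℂ))
    (g := fun p => a p.1 * starRingEnd ℂ (a p.2) * c (p.2 - p.1) *
      ((Real.pi * (((max p.1 p.2)! : ℝ) * n ! / (max p.1 p.2 + n + 1)!) : ℝ) : ℂ))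
    ((summable_norm_mul_coeff_zero h.polyBdd ha).mul_right (Real.pi * 2)) ?_ ?_
  · refine hlim.congr' ?_
    filter_upwards [hmem] with ρ hρ
    have hcont : ContinuousOn (fun z : ℂ => ((‖F z‖ ^ 2 : ℝ) : ℂ) * U z *
        (((1 - ‖z‖ ^ 2) ^ n : ℝ) : ℂ)) (Metric.ball 0 1) := by
      refine ContinuousOn.mul (ContinuousOn.mul ?_ h.continuousOn) ?_
      · exact Complex.continuous_ofReal.comp_continuousOn (hFc.norm.pow 2)
      · exact (Complex.continuous_ofReal.comp (by fun_prop)).continuousOn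
    rw [integral_ball_eq_integral_circleAverage hcont hρ.1 hρ.2]
    have hs := hasSum_intervalIntegral_of_bound (x := 0) (y := ρ)
      (F := fun (p : ℕ × ℕ) (r : ℝ) => a p.1 * starRingEnd ℂ (a p.2) * c (p.2 - p.1) *
        ((Real.pi * (2 * r ^ (2 * max p.1 p.2 + 1) * (1 - r ^ 2) ^ n) : ℝ) : ℂ))
      (f := fun r => ((2 * Real.pi * r : ℝ) : ℂ) * Real.circleAverage
        (fun z : ℂ => ((‖F z‖ ^ 2 : ℝ) : ℂ) * U z * (((1 - ‖z‖ ^ 2) ^ n : ℝ) : ℂ)) 0 r)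
      ((summable_norm_mul_coeff_zero h.polyBdd ha).mul_right (Real.pi * 2)) ?_ ?_ ?_
    · rw [← hs.tsum_eq]
      refine tsum_congr fun p => ?_
      rw [intervalIntegral.integral_const_mul, intervalIntegral.integral_ofReal,
        intervalIntegral.integral_const_mul]
    · intro p
      exact continuous_const.mul (Complex.continuous_ofReal.comp (by fun_prop))
    · intro p r hr
      rw [Set.uIoc_of_le hρ.1.le] at hr
      have hr1 : r ≤ 1 := hr.2.trans hρ.2.le
      have hsq : r ^ 2 ≤ 1 := pow_le_one₀ hr.1.le hr1
      have e1 : r ^ (2 * max p.1 p.2 + 1) ≤ 1 := pow_le_one₀ hr.1.le hr1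
      have e2 : (1 - r ^ 2) ^ n ≤ 1 := pow_le_one₀ (by linarith) (by linarith [sq_nonneg r])
      have e3 : 0 ≤ (1 - r ^ 2) ^ n := pow_nonneg (by linarith) _
      have e4 := pow_nonneg hr.1.le (2 * max p.1 p.2 + 1)
      rw [norm_mul, Complex.norm_real, Real.norm_of_nonneg
        (mul_nonneg Real.pi_pos.le (mul_nonneg (by positivity) e3))]
      gcongr
      nlinarith
    · intro r hr
      rw [Set.uIoc_of_le hρ.1.le] at hr
      have hr1 : r < 1 := hr.2.trans_lt hρ.2
      -- The weight (1-|z|²)^n is constant on each circle, so only the average without it has to be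
      -- expanded.
      have hav : Real.circleAverage (fun z : ℂ => ((‖F z‖ ^ 2 : ℝ) : ℂ) * U z *
          (((1 - ‖z‖ ^ 2) ^ n : ℝ) : ℂ)) 0 r = (((1 - r ^ 2) ^ n : ℝ) : ℂ) *
          Real.circleAverage (fun z => ((‖F z‖ ^ 2 : ℝ) : ℂ) * U z) 0 r := by
        rw [← smul_eq_mul (((1 - r ^ 2) ^ n : ℝ) : ℂ), ← Real.circleAverage_fun_smul]
        refine Real.circleAverage_congr_sphere fun z hz => ?_
        have : ‖z‖ = r := by simpa [abs_of_pos hr.1] using hz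
        simp only [this, smul_eq_mul]
        ring
      have hs := (h.hasSum_circleAverage ha hF hr.1.le hr1).mul_left
        (((2 * Real.pi * r : ℝ) : ℂ) * (((1 - r ^ 2) ^ n : ℝ) : ℂ))
      rw [hav, ← mul_assoc]
      refine hs.congr_fun fun p => ?_
      push_cast
      ring
  · intro p
    have hcI : Continuous fun ρ => I ρ (max p.1 p.2) :=
      intervalIntegral.continuous_primitive
        (fun x y => Continuous.intervalIntegrable (by fun_prop) _ _) 0
    have hc2 : Continuous fun ρ : ℝ => a p.1 * starRingEnd ℂ (a p.2) * c (p.2 - p.1) *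
        ((Real.pi * I ρ (max p.1 p.2) : ℝ) : ℂ) :=
      continuous_const.mul (Complex.continuous_ofReal.comp (continuous_const.mul hcI))
    have := (hc2.tendsto 1).mono_left (nhdsWithin_le_nhds (s := Set.Iio 1))
    have hI1 : I 1 (max p.1 p.2) = _ := integral_pow_mul_one_sub_sq n (max p.1 p.2)
    rwa [hI1] at this
  · filter_upwards [hmem] with ρ hρ p
    rw [norm_mul, Complex.norm_real, Real.norm_eq_abs, abs_mul, abs_of_pos Real.pi_pos]
    gcongr
    exact hIb ρ hρ _

/-! ### The coefficient formula for weighted Dirichlet integrals. -/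

lemma RapidDecay.ascFactorial_mul {a : ℕ → ℂ} (ha : RapidDecay a) (n : ℕ) :
    RapidDecay fun j => ((j + 1).ascFactorial n : ℂ) * a (j + n) := by
  intro N
  obtain ⟨M, hM, h⟩ := ha (N + n)
  refine ⟨M, hM, fun j => le_trans ?_ (h (j + n))⟩
  rw [norm_mul, Complex.norm_natCast, ← mul_assoc, pow_add]
  refine mul_le_mul_of_nonneg_right ?_ (norm_nonneg _)
  have h1 : (((j + 1).ascFactorial n : ℕ) : ℝ) ≤ (1 + ((j + n : ℕ) : ℝ)) ^ n := by
    have := Nat.ascFactorial_le_pow_add j n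
    calc (((j + 1).ascFactorial n : ℕ) : ℝ) ≤ (((j + n) ^ n : ℕ) : ℝ) := by exact_mod_cast this
      _ ≤ _ := by
        rw [Nat.cast_pow]
        exact pow_le_pow_left₀ (by positivity) (by linarith) n
  refine mul_le_mul ?_ h1 (by positivity) (by positivity)
  push_cast
  gcongr
  have : (0 : ℝ) ≤ n := by positivity
  linarith

/-- For j ≤ k the Beta integral cancels the rising factorial of k coming from the derivative. What
remains is the rising factorial of j over (n+1)!, a binomial coefficient of the smaller index; the
normalisation of the Dirichlet integral is exactly what makes this so. -/
lemma choose_eq_ascFactorial_weight (j k n : ℕ) :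
    (1 / (((n + 1)! : ℝ) * n ! * Real.pi)) * (((j + 1).ascFactorial (n + 1) : ℝ) *
      ((k + 1).ascFactorial (n + 1) : ℝ) *
      (Real.pi * (((max j k)! : ℝ) * n ! / (max j k + n + 1)!))) =
      ((min (j + (n + 1)) (k + (n + 1))).choose (n + 1) : ℝ) := by
  wlog hjk : j ≤ k with H
  · have := H k j n (by omega)
    rw [max_comm, min_comm, ← this]
    ring
  rw [max_eq_right hjk, min_eq_left (by omega)]
  have e1 : (((j + 1).ascFactorial (n + 1) : ℕ) : ℝ) =
      ((n + 1)! : ℝ) * ((j + (n + 1)).choose (n + 1) : ℝ) := by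
    exact_mod_cast Nat.ascFactorial_eq_factorial_mul_choose j (n + 1)
  have e2 : ((k + n + 1)! : ℝ) = (k ! : ℝ) * ((k + 1).ascFactorial (n + 1) : ℝ) := by
    exact_mod_cast (Nat.factorial_mul_ascFactorial k (n + 1)).symm
  rw [e1, e2]
  have h1 : ((n + 1)! : ℝ) ≠ 0 := by exact_mod_cast Nat.factorial_ne_zero _
  have h2 : (n ! : ℝ) ≠ 0 := by exact_mod_cast Nat.factorial_ne_zero _
  have h3 : (k ! : ℝ) ≠ 0 := by exact_mod_cast Nat.factorial_ne_zero _
  have h4 : ((k + 1).ascFactorial (n + 1) : ℝ) ≠ 0 := by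
    exact_mod_cast (Nat.ascFactorial_pos k (n + 1)).ne'
  have h5 := Real.pi_ne_zero
  field_simp

/-- The binomial coefficient vanishes when min(j,k) < n, matching the Taylor coefficients killed by
the n-th derivative. -/
lemma form_eq_tsum_add (c : ℤ → ℂ) (n : ℕ) (a : ℕ → ℂ) :
    form c n a = ∑' p : ℕ × ℕ, formTerm c n a (p.1 + n, p.2 + n) := by
  have hinj : Function.Injective fun p : ℕ × ℕ => (p.1 + n, p.2 + n) := by
    rintro ⟨j, k⟩ ⟨j', k'⟩ h
    simpa using h
  refine (hinj.tsum_eq (f := formTerm c n a) ?_).symm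
  rintro ⟨j, k⟩ h
  by_contra hn
  apply h
  have : min j k < n := by
    by_contra hlt
    exact hn ⟨(j - n, k - n), by simp only [Prod.mk.injEq]; omega⟩
  simp [formTerm, Nat.choose_eq_zero_of_lt this]

lemma IsHarmonicExt.tendsto_form_zero {U : ℂ → ℂ} {c : ℤ → ℂ} (h : IsHarmonicExt U c)
    {f : ℂ → ℂ} (hf : IsSmoothAnalytic f) :
    Tendsto (fun r => Real.circleAverage (fun z => ((‖f z‖ ^ 2 : ℝ) : ℂ) * U z) 0 r)
      (𝓝[<] 1) (𝓝 (form c 0 (taylorCoeff f))) := by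
  have h1 := h.tendsto_circleAverage hf.rapidDecay (F := f) fun z hz => by
    simpa using hf.hasSum_iteratedDeriv 0 hz
  simpa [form, formTerm] using h1

lemma IsHarmonicExt.tendsto_form_succ {U : ℂ → ℂ} {c : ℤ → ℂ} (h : IsHarmonicExt U c)
    {f : ℂ → ℂ} (hf : IsSmoothAnalytic f) (n : ℕ) :
    Tendsto (fun r : ℝ => ((1 / ((n + 1)! * n ! * Real.pi) : ℝ) : ℂ) *
        ∫ z in Metric.ball (0 : ℂ) r,
          ((‖iteratedDeriv (n + 1) f z‖ ^ 2 : ℝ) : ℂ) * U z *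
            (((1 - ‖z‖ ^ 2) ^ n : ℝ) : ℂ))
      (𝓝[<] 1) (𝓝 (form c (n + 1) (taylorCoeff f))) := by
  have hcont : ContinuousOn (iteratedDeriv (n + 1) f) (Metric.ball 0 1) := by
    rw [iteratedDeriv_eq_iterate]
    exact (hf.analyticOnNhd.iterated_deriv (n + 1)).continuousOn
  have h1 := (h.tendsto_integral_ball (hf.rapidDecay.ascFactorial_mul (n + 1))
    (fun z hz => hf.hasSum_iteratedDeriv (n + 1) hz) hcont n).const_mul
      ((1 / ((n + 1)! * n ! * Real.pi) : ℝ) : ℂ)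
  convert h1 using 2
  rw [form_eq_tsum_add, ← tsum_mul_left]
  refine tsum_congr fun p => ?_
  rw [formTerm, ← Complex.ofReal_natCast, ← choose_eq_ascFactorial_weight, map_mul,
    Complex.conj_natCast]
  have : ((p.2 + (n + 1) : ℕ) : ℤ) - ((p.1 + (n + 1) : ℕ) : ℤ) = (p.2 : ℤ) - p.1 := by
    push_cast; ring
  simp only [this]
  push_cast
  ring

/-- The coefficient formula for the weighted Dirichlet integrals. -/
lemma dirichletIntegral_eq_form (μ : CircleDistribution) (n : ℕ) {f : ℂ → ℂ}
    (hf : IsSmoothAnalytic f) :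
    dirichletIntegral μ n f = form (distCoeff μ) n (taylorCoeff f) := by
  cases n with
  | zero => exact ((isHarmonicExt_poissonExt μ).tendsto_form_zero hf).limUnder_eq
  | succ n => exact ((isHarmonicExt_poissonExt μ).tendsto_form_succ hf n).limUnder_eq

/-! ### Reality and positivity of forms. -/

lemma IsHarmonicExt.exists_tendsto_ofReal {U : ℂ → ℂ} {c : ℤ → ℂ} (h : IsHarmonicExt U c)
    {u : ℂ → ℝ} (hu : ∀ z : ℂ, ‖z‖ < 1 → U z = u z)
    {f : ℂ → ℂ} (hf : IsSmoothAnalytic f) (n : ℕ) :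
    ∃ X : ℝ → ℝ, Tendsto (fun r => (X r : ℂ)) (𝓝[<] 1) (𝓝 (form c n (taylorCoeff f))) ∧
      ((∀ z : ℂ, ‖z‖ < 1 → 0 ≤ u z) → ∀ r ∈ Set.Ioo (0 : ℝ) 1, 0 ≤ X r) := by
  have hmem : Set.Ioo (0 : ℝ) 1 ∈ 𝓝[<] (1 : ℝ) := Ioo_mem_nhdsLT one_pos
  cases n with
  | zero =>
    refine ⟨fun r => Real.circleAverage (fun z => ‖f z‖ ^ 2 * u z) 0 r,
      (h.tendsto_form_zero hf).congr' ?_, fun hpos r hr => ?_⟩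
    · filter_upwards [hmem] with r hr
      rw [Real.circleAverage_def, Real.circleAverage_def, Complex.real_smul, smul_eq_mul,
        Complex.ofReal_mul, ← intervalIntegral.integral_ofReal]
      congr 2
      ext t
      rw [hu _ (norm_circleMap_lt_one hr.1.le hr.2 t), ← Complex.ofReal_mul]
    · change 0 ≤ Real.circleAverage (fun z => ‖f z‖ ^ 2 * u z) 0 r
      rw [Real.circleAverage_def, smul_eq_mul]
      refine mul_nonneg (inv_nonneg.2 Real.two_pi_pos.le)
        (intervalIntegral.integral_nonneg Real.two_pi_pos.le fun t _ => ?_)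
      exact mul_nonneg (sq_nonneg _) (hpos _ (norm_circleMap_lt_one hr.1.le hr.2 t))
  | succ n =>
    refine ⟨fun r => (1 / ((n + 1)! * n ! * Real.pi) : ℝ) * ∫ z in Metric.ball (0 : ℂ) r,
        ‖iteratedDeriv (n + 1) f z‖ ^ 2 * u z * (1 - ‖z‖ ^ 2) ^ n,
      (h.tendsto_form_succ hf n).congr' ?_, fun hpos r hr => ?_⟩
    · filter_upwards [hmem] with r hr
      rw [Complex.ofReal_mul, ← integral_complex_ofReal]
      congr 1
      refine setIntegral_congr_fun measurableSet_ball fun z hz => ?_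
      have hz1 : ‖z‖ < r := by simpa using hz
      rw [hu z (hz1.trans hr.2)]
      push_cast
      ring
    · refine mul_nonneg (by positivity) (setIntegral_nonneg measurableSet_ball fun z hz => ?_)
      have hz1 : ‖z‖ < 1 := (mem_ball_zero_iff.1 hz).trans hr.2
      have hsq : ‖z‖ ^ 2 ≤ 1 := pow_le_one₀ (norm_nonneg _) hz1.le
      exact mul_nonneg (mul_nonneg (sq_nonneg _) (hpos z hz1)) (pow_nonneg (by linarith) _)

lemma IsHarmonicExt.im_form_eq_zero {U : ℂ → ℂ} {c : ℤ → ℂ} (h : IsHarmonicExt U c)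
    (hU : ∀ z : ℂ, ‖z‖ < 1 → (U z).im = 0) {f : ℂ → ℂ} (hf : IsSmoothAnalytic f) (n : ℕ) :
    (form c n (taylorCoeff f)).im = 0 := by
  obtain ⟨X, hX, -⟩ := h.exists_tendsto_ofReal (u := fun z => (U z).re)
    (fun z hz => Complex.ext rfl (by simpa using hU z hz)) hf n
  have := (Complex.continuous_im.tendsto _).comp hX
  exact tendsto_nhds_unique this (by simp [Function.comp_def])

lemma IsHarmonicExt.re_form_nonneg {U : ℂ → ℂ} {c : ℤ → ℂ} (h : IsHarmonicExt U c)
    (hU : ∀ z : ℂ, ‖z‖ < 1 → 0 ≤ U z) {f : ℂ → ℂ} (hf : IsSmoothAnalytic f) (n : ℕ) :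
    0 ≤ (form c n (taylorCoeff f)).re := by
  obtain ⟨X, hX, hpos⟩ := h.exists_tendsto_ofReal (u := fun z => (U z).re)
    (fun z hz => Complex.ext rfl (by simpa using ((Complex.nonneg_iff.1 (hU z hz)).2).symm)) hf n
  have := (Complex.continuous_re.tendsto _).comp hX
  refine ge_of_tendsto this ?_
  filter_upwards [Ioo_mem_nhdsLT one_pos] with r hr
  exact hpos (fun z hz => (Complex.nonneg_iff.1 (hU z hz)).1) r hr

/-! ### Algebra of forms: linearity in the weight, parallelogram law, behaviour under the shift. -/

lemma form_add {c d : ℤ → ℂ} (hc : PolyBdd c) (hd : PolyBdd d) (n : ℕ) {a : ℕ → ℂ}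
    (ha : RapidDecay a) : form (fun k => c k + d k) n a = form c n a + form d n a := by
  rw [form, form, form, ← (summable_formTerm hc ha n).tsum_add (summable_formTerm hd ha n)]
  refine tsum_congr fun p => ?_
  simp only [formTerm]
  ring

lemma form_const_mul (x : ℂ) (c : ℤ → ℂ) (n : ℕ) (a : ℕ → ℂ) :
    form (fun k => x * c k) n a = x * form c n a := by
  rw [form, form, ← tsum_mul_left]
  refine tsum_congr fun p => ?_
  simp only [formTerm]
  ring

lemma form_parallelogram {c : ℤ → ℂ} (hc : PolyBdd c) (n : ℕ) {a b : ℕ → ℂ}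
    (ha : RapidDecay a) (hb : RapidDecay b) (hadd : RapidDecay (a + b))
    (hsub : RapidDecay (a - b)) :
    form c n (a + b) + form c n (a - b) = 2 * form c n a + 2 * form c n b := by
  simp only [form]
  rw [← (summable_formTerm hc hadd n).tsum_add (summable_formTerm hc hsub n), ← tsum_mul_left,
    ← tsum_mul_left, ← ((summable_formTerm hc ha n).mul_left 2).tsum_add
    ((summable_formTerm hc hb n).mul_left 2)]
  refine tsum_congr fun p => ?_
  simp only [formTerm, Pi.add_apply, Pi.sub_apply, map_add, map_sub]
  ring

lemma form_shift (c : ℤ → ℂ) (n : ℕ) {a b : ℕ → ℂ} (h0 : b 0 = 0) (h : ∀ j, b (j + 1) = a j) :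
    form c n b = ∑' p : ℕ × ℕ, ((min p.1 p.2 + 1).choose n : ℂ) *
      (a p.1 * starRingEnd ℂ (a p.2) * c (p.2 - p.1)) := by
  have hinj : Function.Injective fun p : ℕ × ℕ => (p.1 + 1, p.2 + 1) := by
    rintro ⟨j, k⟩ ⟨j', k'⟩ h
    simpa using h
  rw [form, ← hinj.tsum_eq (f := formTerm c n b)]
  · refine tsum_congr fun p => ?_
    have e1 : ((p.2 + 1 : ℕ) : ℤ) - ((p.1 + 1 : ℕ) : ℤ) = (p.2 : ℤ) - p.1 := by
      push_cast
      ring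
    have e2 : min (p.1 + 1) (p.2 + 1) = min p.1 p.2 + 1 := by omega
    simp only [formTerm, h, e1, e2]
  · rintro ⟨j, k⟩ hjk
    by_contra hn
    apply hjk
    rcases Nat.eq_zero_or_pos j with rfl | hj
    · simp [formTerm, h0]
    · rcases Nat.eq_zero_or_pos k with rfl | hk
      · simp [formTerm, h0]
      · exact absurd ⟨(j - 1, k - 1), by simp only [Prod.mk.injEq]; omega⟩ hn

lemma form_shift_zero (c : ℤ → ℂ) {a b : ℕ → ℂ} (h0 : b 0 = 0) (h : ∀ j, b (j + 1) = a j) :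
    form c 0 b = form c 0 a := by
  rw [form_shift c 0 h0 h]
  simp [form, formTerm]

/-- Pascal's rule for C(min(j,k) + 1, n + 1), applied termwise. -/
lemma form_shift_succ {c : ℤ → ℂ} (hc : PolyBdd c) (n : ℕ) {a b : ℕ → ℂ} (ha : RapidDecay a)
    (h0 : b 0 = 0) (h : ∀ j, b (j + 1) = a j) :
    form c (n + 1) b = form c (n + 1) a + form c n a := by
  rw [form_shift c _ h0 h, form, form,
    ← (summable_formTerm hc ha (n + 1)).tsum_add (summable_formTerm hc ha n)]
  refine tsum_congr fun p => ?_
  rw [formTerm, formTerm, Nat.choose_succ_succ]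
  push_cast
  ring

lemma form_single (c : ℤ → ℂ) (w : ℂ) :
    form c 0 (fun j => if j = 0 then w else 0) = ((‖w‖ ^ 2 : ℝ) : ℂ) * c 0 := by
  rw [form, tsum_eq_single (0, 0)]
  · simp [formTerm, Complex.mul_conj']
  · rintro ⟨j, k⟩ hjk
    rcases Nat.eq_zero_or_pos j with rfl | hj
    · rcases Nat.eq_zero_or_pos k with rfl | hk
      · exact absurd rfl hjk
      · simp [formTerm, hk.ne']
    · simp [formTerm, hj.ne']

/-- These are the coefficients of the constant weight x, for which only the diagonal j = k survives.
-/
lemma form_ite_zero (x : ℂ) (n : ℕ) (a : ℕ → ℂ) :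
    form (fun k => if k = 0 then x else 0) n a =
      x * ((∑' j, (j.choose n : ℝ) * ‖a j‖ ^ 2 : ℝ) : ℂ) := by
  have hinj : Function.Injective fun j : ℕ => (j, j) := fun j k h => (Prod.mk.inj h).1
  rw [form, ← hinj.tsum_eq, Complex.ofReal_tsum, ← tsum_mul_left]
  · refine tsum_congr fun j => ?_
    simp only [formTerm, min_self, sub_self, if_true, Complex.mul_conj']
    push_cast
    ring
  · rintro ⟨j, k⟩ hjk
    by_contra hn
    apply hjk
    have : (k : ℤ) - j ≠ 0 := fun h => hn ⟨j, by simp only [Prod.mk.injEq, true_and]; omega⟩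
    simp [formTerm, this]

lemma polyBdd_ite_zero (x : ℂ) : PolyBdd fun k => if k = 0 then x else 0 := by
  refine ⟨‖x‖, 0, norm_nonneg _, fun k => ?_⟩
  simp only
  split_ifs <;> simp

lemma PolyBdd.add {c d : ℤ → ℂ} (hc : PolyBdd c) (hd : PolyBdd d) :
    PolyBdd fun k => c k + d k := by
  obtain ⟨K, s, hK, h⟩ := hc
  obtain ⟨L, t, hL, h'⟩ := hd
  refine ⟨K + L, s + t, by positivity, fun k => (norm_add_le _ _).trans ?_⟩
  have h1 : (1 : ℝ) ≤ 1 + |(k : ℝ)| := by simp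
  have e1 : (1 + |(k : ℝ)|) ^ s ≤ (1 + |(k : ℝ)|) ^ (s + t) := pow_le_pow_right₀ h1 (by omega)
  have e2 : (1 + |(k : ℝ)|) ^ t ≤ (1 + |(k : ℝ)|) ^ (s + t) := pow_le_pow_right₀ h1 (by omega)
  rw [add_mul]
  exact add_le_add ((h k).trans (mul_le_mul_of_nonneg_left e1 hK))
    ((h' k).trans (mul_le_mul_of_nonneg_left e2 hL))

/-- Permits subtracting a lower bound from a weight, so that positivity of forms applies to U - x.
-/
lemma IsHarmonicExt.add_const {U : ℂ → ℂ} {c : ℤ → ℂ} (h : IsHarmonicExt U c) (x : ℂ) :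
    IsHarmonicExt (fun z => U z + x) fun k => c k + if k = 0 then x else 0 := by
  refine ⟨h.polyBdd.add (polyBdd_ite_zero x), fun z hz => ?_⟩
  refine ((h.hasSum z hz).add (hasSum_ite_eq 0 x)).congr_fun fun k => ?_
  by_cases hk : k = 0
  · subst hk; simp [harmonicPow]
  · simp [hk]

/-- A lower bound of the weight gives a lower bound of the weighted Dirichlet integral. -/
lemma IsHarmonicExt.le_re_form {U : ℂ → ℂ} {c : ℤ → ℂ} (h : IsHarmonicExt U c) {x : ℝ}
    (hU : ∀ z : ℂ, ‖z‖ < 1 → (x : ℂ) ≤ U z) {f : ℂ → ℂ} (hf : IsSmoothAnalytic f) (n : ℕ) :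
    x * ∑' j, (j.choose n : ℝ) * ‖taylorCoeff f j‖ ^ 2 ≤ (form c n (taylorCoeff f)).re := by
  have h1 := (h.add_const (-(x : ℂ))).re_form_nonneg (fun z hz => by
    simpa [← sub_eq_add_neg] using hU z hz) hf n
  rw [form_add h.polyBdd (polyBdd_ite_zero _) n hf.rapidDecay, form_ite_zero, ← Complex.ofReal_neg,
    ← Complex.ofReal_mul, Complex.add_re, Complex.ofReal_re] at h1
  linarith

/-! ### A discrete Hilbert inequality by Schur's test. -/

lemma one_div_mul_sq_le {s t : ℝ} (hs : 0 < s) (ht : 0 < t) (hst : t ^ 2 - s ^ 2 = 1) :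
    1 / (t * t ^ 2) ≤ 2 / s - 2 / t := by
  have hle : s ≤ t := by nlinarith
  rw [div_sub_div _ _ hs.ne' ht.ne', div_le_div_iff₀ (by positivity) (by positivity)]
  have h5 : (t - s) * (t + s) = 1 := by linarith [mul_comm t s]
  have h6 : 1 ≤ (t - s) * (2 * t) := by
    have : 0 ≤ t - s := by linarith
    nlinarith
  nlinarith [mul_le_mul_of_nonneg_left h6 (sq_nonneg t)]

/-- Schur's test for the kernel 1/(1+max(j,k)) with test sequence 1/√(1+k). Split at k = j: below, ∑
1/√(1+k) telescopes against 2√M; above, ∑ (1+k)^{-3/2} telescopes against 2/√N. Each part is at most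
2/√(1+j). -/
lemma sum_schur_le (j N : ℕ) :
    ∑ k ∈ Finset.range N, (1 / (√(1 + (k : ℝ)) * (1 + max (j : ℝ) k))) ≤ 4 / √(1 + (j : ℝ)) := by
  have hj0 : 0 < √(1 + (j : ℝ)) := Real.sqrt_pos.2 (by positivity)
  have low : ∀ M ≤ j + 1, ∑ k ∈ Finset.range M, (1 / (√(1 + (k : ℝ)) * (1 + max (j : ℝ) k))) ≤
      2 * √(M : ℝ) / (1 + j) := by
    intro M
    induction M with
    | zero => simp
    | succ M ih =>
      intro hM
      have hMj : (M : ℝ) ≤ j := by exact_mod_cast (by omega : M ≤ j)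
      rw [Finset.sum_range_succ, max_eq_left hMj]
      refine (add_le_add_left (ih (by omega)) _).trans ?_
      have hs0 : 0 < √(1 + (M : ℝ)) := Real.sqrt_pos.2 (by positivity)
      have e1 : √(1 + (M : ℝ)) ^ 2 = 1 + M := Real.sq_sqrt (by positivity)
      have e2 : √(M : ℝ) ^ 2 = M := Real.sq_sqrt (by positivity)
      have key : 1 / √(1 + (M : ℝ)) ≤ 2 * √(1 + (M : ℝ)) - 2 * √(M : ℝ) := by
        rw [div_le_iff₀ hs0]
        nlinarith [sq_nonneg (√(1 + (M : ℝ)) - √(M : ℝ))]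
      push_cast
      rw [add_comm (M : ℝ) 1, ← div_div, ← add_div]
      gcongr
      linarith
  rcases le_total N (j + 1) with hN | hN
  · refine (low N hN).trans ?_
    rw [div_le_div_iff₀ (by positivity) hj0]
    have e1 : √(1 + (j : ℝ)) ^ 2 = 1 + j := Real.sq_sqrt (by positivity)
    have e2 : √(N : ℝ) ≤ √(1 + (j : ℝ)) := Real.sqrt_le_sqrt (by
      rw [add_comm]; exact_mod_cast hN)
    nlinarith [Real.sqrt_nonneg (N : ℝ)]
  -- The subtracted 2/√N is the remaining tail; it makes the bound inductive.
  · have high : ∑ k ∈ Finset.range N, (1 / (√(1 + (k : ℝ)) * (1 + max (j : ℝ) k))) ≤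
        4 / √(1 + (j : ℝ)) - 2 / √(N : ℝ) := by
      induction N, hN using Nat.le_induction with
      | base =>
        refine (low _ le_rfl).trans_eq ?_
        push_cast
        rw [add_comm (j : ℝ) 1]
        have e1 : √(1 + (j : ℝ)) ^ 2 = 1 + j := Real.sq_sqrt (by positivity)
        have : 2 * √(1 + (j : ℝ)) / (1 + j) = 2 / √(1 + (j : ℝ)) := by
          rw [div_eq_div_iff (by positivity) hj0.ne']
          nlinarith
        rw [this]
        ring
      | succ N hN ih =>
        have hNj : (j : ℝ) ≤ N := by exact_mod_cast (by omega : j ≤ N)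
        rw [Finset.sum_range_succ, max_eq_right hNj]
        refine (add_le_add_left ih _).trans ?_
        have hN0 : (0 : ℝ) < N := by exact_mod_cast (by omega : 0 < N)
        have hs : 0 < √(N : ℝ) := Real.sqrt_pos.2 hN0
        have ht : 0 < √(1 + (N : ℝ)) := Real.sqrt_pos.2 (by positivity)
        have e1 : √(1 + (N : ℝ)) ^ 2 = 1 + N := Real.sq_sqrt (by positivity)
        have e2 : √(N : ℝ) ^ 2 = N := Real.sq_sqrt (by positivity)
        push_cast
        rw [add_comm (N : ℝ) 1]
        have key : 1 / (√(1 + (N : ℝ)) * (1 + N)) ≤ 2 / √(N : ℝ) - 2 / √(1 + (N : ℝ)) := by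
          conv_lhs => rw [show √(1 + (N : ℝ)) * (1 + N) = √(1 + (N : ℝ)) * √(1 + (N : ℝ)) ^ 2 by rw [e1]]
          exact one_div_mul_sq_le hs ht (by linarith)
        linarith
    have : 0 ≤ 2 / √(N : ℝ) := by positivity
    linarith

/-- A discrete Hilbert inequality. -/
lemma sum_sum_div_max_le (b : ℕ → ℝ) (N : ℕ) :
    ∑ j ∈ Finset.range N, ∑ k ∈ Finset.range N, b j * b k / (1 + max (j : ℝ) k) ≤
      4 * ∑ j ∈ Finset.range N, b j ^ 2 := by
  -- The weighted inequality 2 b_j b_k ≤ b_j² √((1+j)/(1+k)) + b_k² √((1+k)/(1+j)) bounds each term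
  -- by the symmetrisation of g, whose rows are summed by `sum_schur_le`.
  set g : ℕ → ℕ → ℝ := fun j k =>
    b j ^ 2 * (√(1 + (j : ℝ)) * (1 / (√(1 + (k : ℝ)) * (1 + max (j : ℝ) k)))) with hg
  have hpt : ∀ j k, b j * b k / (1 + max (j : ℝ) k) ≤ (g j k + g k j) / 2 := by
    intro j k
    have hj : 0 < √(1 + (j : ℝ)) := Real.sqrt_pos.2 (by positivity)
    have hk : 0 < √(1 + (k : ℝ)) := Real.sqrt_pos.2 (by positivity)
    have hm : 0 < 1 + max (j : ℝ) k := by positivity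
    have e : g j k + g k j = ((b j * √(1 + (j : ℝ))) ^ 2 + (b k * √(1 + (k : ℝ))) ^ 2) /
        (√(1 + (j : ℝ)) * √(1 + (k : ℝ)) * (1 + max (j : ℝ) k)) := by
      simp only [hg, max_comm (k : ℝ) j]
      field_simp
    rw [e, div_div, div_le_div_iff₀ hm (by positivity)]
    have := two_mul_le_add_sq (b j * √(1 + (j : ℝ))) (b k * √(1 + (k : ℝ)))
    nlinarith
  have hrow : ∀ j, ∑ k ∈ Finset.range N, g j k ≤ 4 * b j ^ 2 := by
    intro j
    have hj : 0 < √(1 + (j : ℝ)) := Real.sqrt_pos.2 (by positivity)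
    simp only [hg]
    rw [← Finset.mul_sum, ← Finset.mul_sum, mul_comm 4]
    refine mul_le_mul_of_nonneg_left ?_ (sq_nonneg _)
    refine (mul_le_mul_of_nonneg_left (sum_schur_le j N) hj.le).trans_eq ?_
    field_simp
  calc ∑ j ∈ Finset.range N, ∑ k ∈ Finset.range N, b j * b k / (1 + max (j : ℝ) k)
      ≤ ∑ j ∈ Finset.range N, ∑ k ∈ Finset.range N, (g j k + g k j) / 2 :=
        Finset.sum_le_sum fun j _ => Finset.sum_le_sum fun k _ => hpt j k
    _ = ∑ j ∈ Finset.range N, ∑ k ∈ Finset.range N, g j k := by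
        simp only [← Finset.sum_div, Finset.sum_add_distrib]
        rw [Finset.sum_comm (f := fun j k => g k j)]
        ring
    _ ≤ ∑ j ∈ Finset.range N, 4 * b j ^ 2 := Finset.sum_le_sum fun j _ => hrow j
    _ = _ := by rw [Finset.mul_sum]

/-! ### Upper bounds of forms by weighted ℓ² norms. -/

lemma RapidDecay.summable_pow_mul_sq {a : ℕ → ℂ} (ha : RapidDecay a) (p : ℕ) :
    Summable fun j : ℕ => (1 + (j : ℝ)) ^ p * ‖a j‖ ^ 2 := by
  obtain ⟨M, hM, h⟩ := ha 0
  refine Summable.of_nonneg_of_le (fun j => by positivity) (fun j => ?_)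
    ((ha.summable_pow_mul_norm p).mul_right M)
  have := h j
  rw [pow_zero, one_mul] at this
  rw [sq, ← mul_assoc]
  exact mul_le_mul_of_nonneg_left this (by positivity)

/-- The Hilbert inequality applied to b_j = w_j |a_j| on finite squares; its constant gives the
factor 4. -/
lemma norm_form_le {c : ℤ → ℂ} (hc : PolyBdd c) {n p : ℕ} {B : ℝ} (hB : 0 ≤ B) {w : ℕ → ℝ}
    (hw : ∀ j, w j ^ 2 = (1 + (j : ℝ)) ^ p)
    (hker : ∀ j k : ℕ, ((min j k).choose n : ℝ) * ‖c (k - j)‖ ≤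
      B * (w j * w k / (1 + max (j : ℝ) k))) {a : ℕ → ℂ} (ha : RapidDecay a) :
    ‖form c n a‖ ≤ 4 * B * ∑' j : ℕ, (1 + (j : ℝ)) ^ p * ‖a j‖ ^ 2 := by
  have hs := (summable_formTerm hc ha n).norm
  refine (norm_tsum_le_tsum_norm hs).trans (hs.tsum_le_of_sum_le fun s => ?_)
  have hterm : ∀ q : ℕ × ℕ, ‖formTerm c n a q‖ ≤
      B * ((w q.1 * ‖a q.1‖) * (w q.2 * ‖a q.2‖) / (1 + max (q.1 : ℝ) q.2)) := by
    intro q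
    rw [formTerm, norm_mul, norm_mul, norm_mul, RCLike.norm_conj, Complex.norm_natCast]
    calc _ = ((min q.1 q.2).choose n : ℝ) * ‖c (q.2 - q.1)‖ * (‖a q.1‖ * ‖a q.2‖) := by ring
      _ ≤ B * (w q.1 * w q.2 / (1 + max (q.1 : ℝ) q.2)) * (‖a q.1‖ * ‖a q.2‖) := by
        exact mul_le_mul_of_nonneg_right (hker _ _) (by positivity)
      _ = _ := by ring
  obtain ⟨N, hN⟩ : ∃ N, s ⊆ Finset.range N ×ˢ Finset.range N := by
    refine ⟨s.sup (fun q => q.1 + q.2) + 1, fun q hq => ?_⟩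
    have := Finset.le_sup (f := fun q : ℕ × ℕ => q.1 + q.2) hq
    simp only [Finset.mem_product, Finset.mem_range]
    change q.1 + q.2 ≤ _ at this
    omega
  calc ∑ q ∈ s, ‖formTerm c n a q‖
      ≤ ∑ q ∈ Finset.range N ×ˢ Finset.range N, ‖formTerm c n a q‖ :=
        Finset.sum_le_sum_of_subset_of_nonneg hN fun _ _ _ => norm_nonneg _
    _ ≤ ∑ q ∈ Finset.range N ×ˢ Finset.range N,
        B * ((w q.1 * ‖a q.1‖) * (w q.2 * ‖a q.2‖) / (1 + max (q.1 : ℝ) q.2)) :=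
        Finset.sum_le_sum fun q _ => hterm q
    _ = B * ∑ j ∈ Finset.range N, ∑ k ∈ Finset.range N,
        (w j * ‖a j‖) * (w k * ‖a k‖) / (1 + max (j : ℝ) k) := by
        rw [← Finset.mul_sum, Finset.sum_product]
    _ ≤ B * (4 * ∑ j ∈ Finset.range N, (w j * ‖a j‖) ^ 2) :=
        mul_le_mul_of_nonneg_left
          (sum_sum_div_max_le (fun j => w j * ‖a j‖) N) hB
    _ = 4 * B * ∑ j ∈ Finset.range N, (1 + (j : ℝ)) ^ p * ‖a j‖ ^ 2 := by
        simp only [mul_pow, hw]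
        ring
    _ ≤ _ := by
        refine mul_le_mul_of_nonneg_left ?_ (by positivity)
        exact (ha.summable_pow_mul_sq p).sum_le_tsum _ fun _ _ => by positivity

/-- For n ≤ q compare exponents separately. For n > q the excess x^{n-q} is at most y^{n-q} and
moves to the larger variable, where the second hypothesis leaves room. Used with x, y equal to one
plus the smaller and larger index, and q = p/2. -/
lemma pow_mul_rpow_le {x y s q : ℝ} {n : ℕ} (hx : 1 ≤ x) (hxy : x ≤ y) (hs : s ≤ q - 1)
    (hns : n + s ≤ 2 * q - 1) : x ^ n * y ^ s ≤ x ^ q * y ^ q / y := by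
  have hx0 : 0 < x := by linarith
  have hy0 : 0 < y := by linarith
  have hy : 1 ≤ y := hx.trans hxy
  rw [← Real.rpow_natCast x n, mul_div_assoc, ← Real.rpow_sub_one hy0.ne']
  rcases le_total (n : ℝ) q with h | h
  · exact mul_le_mul (Real.rpow_le_rpow_of_exponent_le hx h)
      (Real.rpow_le_rpow_of_exponent_le hy hs) (by positivity) (by positivity)
  · calc x ^ (n : ℝ) * y ^ s = x ^ q * x ^ ((n : ℝ) - q) * y ^ s := by
          rw [← Real.rpow_add hx0]; ring_nf
      _ ≤ x ^ q * y ^ ((n : ℝ) - q) * y ^ s := by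
          have := Real.rpow_le_rpow hx0.le hxy (sub_nonneg.2 h)
          gcongr
      _ = x ^ q * y ^ ((n : ℝ) - q + s) := by rw [Real.rpow_add hy0]; ring
      _ ≤ x ^ q * y ^ (q - 1) := by
          have := Real.rpow_le_rpow_of_exponent_le hy (show (n : ℝ) - q + s ≤ q - 1 by linarith)
          gcongr

/-- Forms of low order with coefficients of moderate growth are controlled by a weighted
`ℓ²` norm. -/
lemma exists_norm_form_le {c : ℤ → ℂ} (hc : PolyBdd c) {n p : ℕ} {K s : ℝ} (hK : 0 ≤ K)
    (hs0 : 0 ≤ s) (hs : s ≤ ((p : ℝ) - 2) / 2) (hns : n + s ≤ (p : ℝ) - 1)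
    (h : ∀ k, ‖c k‖ ≤ K * (1 + |(k : ℝ)|) ^ s) :
    ∃ B : ℝ, 0 ≤ B ∧ ∀ a : ℕ → ℂ, RapidDecay a →
      ‖form c n a‖ ≤ B * ∑' j : ℕ, (1 + (j : ℝ)) ^ p * ‖a j‖ ^ 2 := by
  refine ⟨4 * K, by positivity, fun a ha =>
    norm_form_le hc hK (w := fun j => (1 + (j : ℝ)) ^ ((p : ℝ) / 2))
      (fun j => ?_) (fun j k => ?_) ha⟩
  · rw [← Real.rpow_natCast, ← Real.rpow_mul (by positivity)]
    rw [← Real.rpow_natCast]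
    congr 1
    push_cast
    ring
  -- Allowing either sign of l covers both orderings of the indices by symmetry.
  · have key : ∀ j k : ℕ, j ≤ k → ∀ l : ℤ, |l| = (k : ℤ) - j →
        ((min j k).choose n : ℝ) * ‖c l‖ ≤
        K * ((1 + (j : ℝ)) ^ ((p : ℝ) / 2) * (1 + (k : ℝ)) ^ ((p : ℝ) / 2) /
          (1 + max (j : ℝ) k)) := by
      intro j k hjk l hl
      have hjk' : (j : ℝ) ≤ k := by exact_mod_cast hjk
      have hl' : |(l : ℝ)| = (k : ℝ) - j := by exact_mod_cast hl
      rw [max_eq_right hjk', min_eq_left hjk]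
      have h1 : ((j.choose n : ℕ) : ℝ) ≤ (1 + (j : ℝ)) ^ n := by
        have : ((j.choose n : ℕ) : ℝ) ≤ (j : ℝ) ^ n := by exact_mod_cast Nat.choose_le_pow _ _
        refine this.trans ?_
        gcongr
        linarith
      have h2 : ‖c l‖ ≤ K * (1 + (k : ℝ)) ^ s := by
        refine (h l).trans (mul_le_mul_of_nonneg_left ?_ hK)
        refine Real.rpow_le_rpow (by positivity) ?_ hs0
        rw [hl']
        linarith [(Nat.cast_nonneg j : (0 : ℝ) ≤ j)]
      calc _ ≤ (1 + (j : ℝ)) ^ n * (K * (1 + (k : ℝ)) ^ s) :=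
            mul_le_mul h1 h2 (norm_nonneg _) (by positivity)
        _ = K * ((1 + (j : ℝ)) ^ n * (1 + (k : ℝ)) ^ s) := by ring
        _ ≤ _ := by
            refine mul_le_mul_of_nonneg_left ?_ hK
            exact pow_mul_rpow_le (by simp) (by linarith) (by linarith) (by linarith)
    rcases le_total j k with hjk | hjk
    · exact key j k hjk _ (abs_of_nonneg (by omega))
    · have := key k j hjk (k - j) (by rw [abs_of_nonpos (by omega)]; ring)
      rwa [min_comm, max_comm, mul_comm (_ ^ _ : ℝ)] at this

/-! ### Positive and real distributions; coefficient growth of derivatives of measures. -/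

lemma poissonFun_nonneg (z : ℂ) (hz : ‖z‖ < 1) (ζ : Circle) :
    0 ≤ (1 - ‖z‖ ^ 2) / ‖(ζ : ℂ) - z‖ ^ 2 := by
  have : ‖z‖ ^ 2 ≤ 1 := pow_le_one₀ (norm_nonneg _) hz.le
  exact div_nonneg (by linarith) (sq_nonneg _)

lemma IsPositiveDist.poissonExt_nonneg {μ : CircleDistribution} (h : IsPositiveDist μ) {z : ℂ}
    (hz : ‖z‖ < 1) : 0 ≤ poissonExt μ z := by
  rw [poissonExt, dif_pos hz]
  exact h _ fun ζ => Complex.zero_le_real.2 (poissonFun_nonneg z hz ζ)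

lemma IsRealDist.poissonExt_im {μ : CircleDistribution} (h : IsRealDist μ) {z : ℂ}
    (hz : ‖z‖ < 1) : (poissonExt μ z).im = 0 := by
  rw [poissonExt, dif_pos hz]
  exact h _ fun ζ => Complex.ofReal_im _

lemma norm_integral_zpow_le (ν : Measure Circle) [IsFiniteMeasure ν] (k : ℤ) :
    ‖∫ ζ : Circle, ((ζ ^ k : Circle) : ℂ) ∂ν‖ ≤ ν.real Set.univ := by
  have := norm_integral_le_of_norm_le_const (μ := ν) (f := fun ζ : Circle => ((ζ ^ k : Circle) : ℂ))
    (C := 1) (Eventually.of_forall fun ζ => (Circle.norm_coe _).le)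
  simpa using this

lemma exists_norm_signedCoeff_le (ν : SignedMeasure Circle) :
    ∃ K : ℝ, 0 ≤ K ∧ ∀ k, ‖signedCoeff ν k‖ ≤ K := by
  refine ⟨ν.toJordanDecomposition.posPart.real Set.univ +
    ν.toJordanDecomposition.negPart.real Set.univ, by positivity, fun k => ?_⟩
  exact (norm_sub_le _ _).trans (add_le_add (norm_integral_zpow_le _ _) (norm_integral_zpow_le _ _))

lemma exists_norm_measureCoeff_le (ν : ComplexMeasure Circle) :
    ∃ K : ℝ, 0 ≤ K ∧ ∀ k, ‖measureCoeff ν k‖ ≤ K := by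
  obtain ⟨K, hK, h⟩ := exists_norm_signedCoeff_le (ComplexMeasure.re ν)
  obtain ⟨L, hL, h'⟩ := exists_norm_signedCoeff_le (ComplexMeasure.im ν)
  refine ⟨K + L, by positivity, fun k => (norm_add_le _ _).trans ?_⟩
  rw [norm_mul, Complex.norm_I, one_mul]
  exact add_le_add (h k) (h' k)

/-- Coefficients of a finite measure are bounded, and D^j multiplies them by |k|^j. This growth is
all that the proof uses of the measure representations. -/
lemma IsSumOfDerivatives.exists_norm_distCoeff_le {μ : CircleDistribution} {J : ℕ}
    (h : IsSumOfDerivatives μ J) :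
    ∃ K : ℝ, 0 ≤ K ∧ ∀ k, ‖distCoeff μ k‖ ≤ K * (1 + |(k : ℝ)|) ^ (J : ℝ) := by
  obtain ⟨ν, hν⟩ := h
  choose K hK hKν using fun j => exists_norm_measureCoeff_le (ν j)
  refine ⟨∑ j ∈ Finset.range (J + 1), K j, Finset.sum_nonneg fun j _ => hK j, fun k => ?_⟩
  rw [hν, Finset.sum_mul]
  refine (norm_sum_le _ _).trans (Finset.sum_le_sum fun j hj => ?_)
  have hj' : j ≤ J := by simpa [Nat.lt_succ_iff] using hj
  rw [norm_mul, norm_pow, Complex.norm_intCast, Int.cast_abs, abs_abs, mul_comm, Real.rpow_natCast]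
  refine mul_le_mul (hKν j k) ?_ (by positivity) (hK j)
  calc |(k : ℝ)| ^ j ≤ (1 + |(k : ℝ)|) ^ j := by gcongr; linarith
    _ ≤ _ := pow_le_pow_right₀ (by simp) hj'

/-! ### Control of a weighted ℓ² norm by two forms. -/

/-- Write f = f(0) + zg, so that coefficient j + 1 of f is coefficient j of g. With V the order-0
form, shift invariance gives V(g) = V(f - f(0)), and the parallelogram law with V ≥ 0 bounds this by
2V(f) + 2V(f(0)). Finally V(f(0)) = |f(0)|² c(0), which the hypothesis on the mean value controls by
V(f). -/
lemma exists_norm_taylorCoeff_sq_le {U : ℂ → ℂ} {c : ℤ → ℂ} (h : IsHarmonicExt U c)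
    (hU : ∀ z : ℂ, ‖z‖ < 1 → 0 ≤ U z) {K : ℝ} (hK : 0 ≤ K)
    (h0 : ∀ f, IsSmoothAnalytic f → ‖taylorCoeff f 0‖ ^ 2 ≤ K * (form c 0 (taylorCoeff f)).re)
    (j : ℕ) : ∃ L : ℝ, 0 ≤ L ∧ ∀ f, IsSmoothAnalytic f →
      ‖taylorCoeff f j‖ ^ 2 ≤ L * (form c 0 (taylorCoeff f)).re := by
  induction j with
  | zero => exact ⟨K, hK, h0⟩
  | succ j ih =>
    obtain ⟨L, hL, hLf⟩ := ih
    refine ⟨L * (2 + 2 * (K * ‖c 0‖)), by positivity, fun f hf => ?_⟩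
    obtain ⟨g, hg, hfg⟩ := hf.exists_backwardShift
    have hc := isSmoothAnalytic_const (f 0)
    have hsum : taylorCoeff f = taylorCoeff (fun _ => f 0) + taylorCoeff fun z => z * g z := by
      conv_lhs => rw [hfg]
      exact funext fun i => hc.taylorCoeff_add hg.id_mul i
    have hsub : taylorCoeff f - taylorCoeff (fun _ => f 0) = taylorCoeff fun z => z * g z := by
      rw [hsum, add_sub_cancel_left]
    have hadd : taylorCoeff f + taylorCoeff (fun _ => f 0) =
        taylorCoeff fun z => f z + f 0 := funext fun i => (hf.taylorCoeff_add hc i).symm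
    have hpar := form_parallelogram h.polyBdd 0 hf.rapidDecay hc.rapidDecay
      (hadd ▸ (hf.add hc).rapidDecay) (hsub ▸ hg.id_mul.rapidDecay)
    have hconst : form c 0 (taylorCoeff fun _ => f 0) = ((‖f 0‖ ^ 2 : ℝ) : ℂ) * c 0 := by
      rw [funext (taylorCoeff_const (f 0)), form_single]
    rw [hadd, hsub, hconst, form_shift_zero c hg.taylorCoeff_id_mul_zero
      (taylorCoeff_id_mul_succ g)] at hpar
    have hre := congrArg Complex.re hpar
    have two_re : ∀ w : ℂ, (2 * w).re = 2 * w.re := fun w => by simp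
    simp only [Complex.add_re, two_re, Complex.re_ofReal_mul] at hre
    have hpos := h.re_form_nonneg hU (hf.add hc) 0
    have hj : taylorCoeff f (j + 1) = taylorCoeff g j := by
      rw [hsum, Pi.add_apply, taylorCoeff_const, if_neg (Nat.succ_ne_zero j), zero_add,
        taylorCoeff_id_mul_succ]
    have hf0 := h0 f hf
    rw [hf.taylorCoeff_zero] at hf0
    have h1 : ‖f 0‖ ^ 2 * (c 0).re ≤ K * (form c 0 (taylorCoeff f)).re * ‖c 0‖ :=
      (mul_le_mul_of_nonneg_left (Complex.re_le_norm _) (sq_nonneg _)).trans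
        (mul_le_mul_of_nonneg_right hf0 (norm_nonneg _))
    rw [hj, mul_assoc]
    refine (hLf g hg).trans (mul_le_mul_of_nonneg_left ?_ hL)
    linarith

/-- For j ≥ p, p! C(j,p) is at least (j+1-p)^p, and 1 + j ≤ (p+1)(j+1-p). For j < p the binomial
coefficient is 0 and the indicator takes over. -/
lemma one_add_pow_le_choose (p j : ℕ) : (1 + (j : ℝ)) ^ p ≤
    ((p + 1 : ℕ) : ℝ) ^ p * p ! * ((j.choose p : ℝ) + if j < p then 1 else 0) := by
  split_ifs with h
  · have h1 : (1 + (j : ℝ)) ^ p ≤ ((p + 1 : ℕ) : ℝ) ^ p := by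
      refine pow_le_pow_left₀ (by positivity) ?_ p
      rw [add_comm]
      exact_mod_cast (by omega : j + 1 ≤ p + 1)
    have h2 : (1 : ℝ) ≤ p ! := by exact_mod_cast Nat.factorial_pos p
    rw [Nat.choose_eq_zero_of_lt h, Nat.cast_zero, zero_add, mul_one]
    exact h1.trans (le_mul_of_one_le_right (by positivity) h2)
  · have h1 : (j + 1 - p) ^ p ≤ p ! * j.choose p := by
      rw [← Nat.descFactorial_eq_factorial_mul_choose]
      exact Nat.pow_sub_le_descFactorial j p
    have h2 : 1 + j ≤ (p + 1) * (j + 1 - p) := by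
      obtain ⟨d, rfl⟩ := Nat.exists_eq_add_of_le (not_lt.1 h)
      rw [show p + d + 1 - p = d + 1 by omega]
      nlinarith [Nat.zero_le (p * d)]
    have h3 : (1 + j) ^ p ≤ (p + 1) ^ p * (p ! * j.choose p) :=
      (Nat.pow_le_pow_left h2 p).trans (by rw [mul_pow]; exact Nat.mul_le_mul_left _ h1)
    rw [add_zero, mul_assoc]
    exact_mod_cast h3

lemma tsum_one_add_pow_le {a : ℕ → ℂ} (ha : RapidDecay a) (p : ℕ) :
    ∑' j : ℕ, (1 + (j : ℝ)) ^ p * ‖a j‖ ^ 2 ≤ ((p + 1 : ℕ) : ℝ) ^ p * p ! *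
      (∑' j : ℕ, (j.choose p : ℝ) * ‖a j‖ ^ 2 + ∑ j ∈ Finset.range p, ‖a j‖ ^ 2) := by
  have h1 : Summable fun j : ℕ => (j.choose p : ℝ) * ‖a j‖ ^ 2 := by
    refine Summable.of_nonneg_of_le (fun j => by positivity) (fun j => ?_)
      (ha.summable_pow_mul_sq p)
    refine mul_le_mul_of_nonneg_right ?_ (sq_nonneg _)
    have : ((j.choose p : ℕ) : ℝ) ≤ (j : ℝ) ^ p := by exact_mod_cast Nat.choose_le_pow _ _
    exact this.trans (pow_le_pow_left₀ (by positivity) (by linarith) p)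
  have hz : ∀ j ∉ Finset.range p, (if j < p then ‖a j‖ ^ 2 else 0) = 0 := fun j hj =>
    if_neg (by simpa using hj)
  have h2 : Summable fun j : ℕ => if j < p then ‖a j‖ ^ 2 else 0 := summable_of_ne_finset_zero hz
  have h3 : ∑' j : ℕ, (if j < p then ‖a j‖ ^ 2 else 0) = ∑ j ∈ Finset.range p, ‖a j‖ ^ 2 := by
    rw [tsum_eq_sum hz]
    exact Finset.sum_congr rfl fun j hj => if_pos (by simpa using hj)
  rw [← h3, ← h1.tsum_add h2, ← tsum_mul_left]
  refine (ha.summable_pow_mul_sq p).tsum_le_tsum (fun j => ?_) ((h1.add h2).mul_left _)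
  refine (mul_le_mul_of_nonneg_right (one_add_pow_le_choose p j) (sq_nonneg _)).trans_eq ?_
  split_ifs <;> ring

/-- The sum of a form of order `0` controlling the mean value and a form of order `p` with weight
bounded below controls a weighted `ℓ²` norm. -/
lemma exists_tsum_one_add_pow_le {U V : ℂ → ℂ} {c d : ℤ → ℂ} (h : IsHarmonicExt U c)
    (hU : ∀ z : ℂ, ‖z‖ < 1 → 0 ≤ U z) {K : ℝ} (hK : 0 ≤ K)
    (h0 : ∀ f, IsSmoothAnalytic f → ‖taylorCoeff f 0‖ ^ 2 ≤ K * (form c 0 (taylorCoeff f)).re)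
    (hd : IsHarmonicExt V d) {x : ℝ} (hx : 0 < x) (hV : ∀ z : ℂ, ‖z‖ < 1 → (x : ℂ) ≤ V z)
    (p : ℕ) : ∃ B : ℝ, 0 ≤ B ∧ ∀ f, IsSmoothAnalytic f →
      ∑' j : ℕ, (1 + (j : ℝ)) ^ p * ‖taylorCoeff f j‖ ^ 2 ≤
        B * ((form c 0 (taylorCoeff f)).re + (form d p (taylorCoeff f)).re) := by
  choose L hL hLf using exists_norm_taylorCoeff_sq_le h hU hK h0
  set M : ℝ := ((p + 1 : ℕ) : ℝ) ^ p * p ! with hM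
  set T : ℝ := ∑ j ∈ Finset.range p, L j with hT
  have hT0 : 0 ≤ T := Finset.sum_nonneg fun j _ => hL j
  -- M compares (1+j)^p with the binomial coefficient, x⁻¹ comes from the lower bound of V, and T
  -- from the first p Taylor coefficients.
  refine ⟨M * (x⁻¹ + T), by positivity, fun f hf => ?_⟩
  have h1 := hd.le_re_form hV hf p
  have h2 : ∑ j ∈ Finset.range p, ‖taylorCoeff f j‖ ^ 2 ≤ T * (form c 0 (taylorCoeff f)).re := by
    rw [hT, Finset.sum_mul]
    exact Finset.sum_le_sum fun j _ => hLf j f hf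
  have h3 := h.re_form_nonneg hU hf 0
  have h4 := hd.re_form_nonneg
    (fun z hz => (Complex.zero_le_real.2 hx.le).trans (hV z hz)) hf p
  have h5 : ∑' j : ℕ, (j.choose p : ℝ) * ‖taylorCoeff f j‖ ^ 2 ≤
      x⁻¹ * (form d p (taylorCoeff f)).re := by
    rw [inv_mul_eq_div, le_div_iff₀ hx, mul_comm]
    exact h1
  refine (tsum_one_add_pow_le hf.rapidDecay p).trans ?_
  rw [mul_assoc M]
  refine mul_le_mul_of_nonneg_left ?_ (by positivity)
  have h6 : 0 ≤ x⁻¹ := (inv_pos.2 hx).le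
  nlinarith [mul_nonneg h6 h3, mul_nonneg hT0 h4]

/-! ### The quadratic form of the perturbed tuple. -/

lemma form_distCoeff_add (μ ν : CircleDistribution) (n : ℕ) {a : ℕ → ℂ} (ha : RapidDecay a) :
    form (distCoeff (μ + ν)) n a = form (distCoeff μ) n a + form (distCoeff ν) n a :=
  form_add (polyBdd_distCoeff μ) (polyBdd_distCoeff ν) n ha

lemma form_distCoeff_smul (x : ℂ) (μ : CircleDistribution) (n : ℕ) (a : ℕ → ℂ) :
    form (distCoeff (x • μ)) n a = x * form (distCoeff μ) n a :=
  form_const_mul x (distCoeff μ) n a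

lemma sum_form_single {m : ℕ} (i : Fin m) (μ : CircleDistribution) (a : ℕ → ℂ) :
    ∑ n : Fin m, form (distCoeff ((Pi.single i μ : Fin m → CircleDistribution) n)) n a =
      form (distCoeff μ) i a := by
  rw [Finset.sum_eq_single i]
  · rw [Pi.single_eq_same]
  · intro n _ hn
    rw [Pi.single_eq_of_ne hn]
    simp [form, formTerm, distCoeff]
  · simp

lemma dirichletForm_single_add_single {m : ℕ} (i j : Fin m) (μ : Fin m → CircleDistribution)
    (ν κ : CircleDistribution) (C : ℂ) {f : ℂ → ℂ} (hf : IsSmoothAnalytic f) :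
    dirichletForm (Pi.single i (C • ν) + μ + Pi.single j (C • κ)) f =
      C * form (distCoeff ν) i (taylorCoeff f) +
        ∑ n : Fin m, form (distCoeff (μ n)) n (taylorCoeff f) +
        C * form (distCoeff κ) j (taylorCoeff f) := by
  simp only [dirichletForm, Pi.add_apply, dirichletIntegral_eq_form _ _ hf,
    form_distCoeff_add _ _ _ hf.rapidDecay, Finset.sum_add_distrib, sum_form_single,
    form_distCoeff_smul]

end CircleDirichlet

end

/-! ### The theorem. -/

open CircleDirichlet in
theorem theorem5p5 (m : ℕ) (hm : 3 ≤ m)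
    (μ : Fin m → CircleDistribution) (ν : CircleDistribution)
    (hreal : ∀ n : Fin m, IsRealDist (μ n))
    (hν : IsPositiveDist ν)
    (hν₀ : ∃ K : ℝ, 0 < K ∧ ∀ f : ℂ → ℂ, IsSmoothAnalytic f →
      ((‖circleCoeff (fun ζ : Circle => f ζ) 0‖ ^ 2 : ℝ) : ℂ) ≤ (K : ℂ) * dirichletIntegral ν 0 f)
    (hlow : ∀ n : Fin m, (n : ℝ) ≤ ((m : ℝ) - 3) / 2 →
      ∃ K : ℝ, 0 < K ∧ ∀ k : ℤ,
        ‖distCoeff (μ n) k‖ ≤ K * (1 + |(k : ℝ)|) ^ (((m : ℝ) - 3) / 2))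
    (hmid : ∀ n : Fin m, Even m → (n : ℕ) = (m - 2) / 2 →
      IsSumOfDerivatives (μ n) ((m - 4) / 2))
    (hhigh : ∀ n : Fin m, ((m : ℝ) - 1) / 2 ≤ (n : ℝ) → (n : ℕ) ≤ m - 2 →
      IsSumOfDerivatives (μ n) (m - 2 - n))
    (hlast : ∃ c : ℝ, 0 < c ∧ ∀ z : ℂ, ‖z‖ < 1 →
      (c : ℂ) ≤ poissonExt (μ ⟨m - 1, by omega⟩) z) :
    ∃ C₀ : ℝ, 0 < C₀ ∧ ∀ C : ℝ, C₀ ≤ C →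
      IsAllowable (Pi.single ⟨0, by omega⟩ ((C : ℂ) • ν) + μ +
        Pi.single ⟨m - 1, by omega⟩ ((C : ℂ) • μ ⟨m - 1, by omega⟩)) := by
  obtain ⟨K, hK, hKf⟩ := hν₀
  obtain ⟨x, hx, hxz⟩ := hlast
  set l : Fin m := ⟨m - 1, by omega⟩ with hl
  have hm3 : (3 : ℝ) ≤ m := by exact_mod_cast hm
  have hp : ((m - 1 : ℕ) : ℝ) = (m : ℝ) - 1 := by
    rw [Nat.cast_sub (by omega), Nat.cast_one]
  have hH := isHarmonicExt_poissonExt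
  have hUl : ∀ z : ℂ, ‖z‖ < 1 → 0 ≤ poissonExt (μ l) z := fun z hz =>
    (Complex.zero_le_real.2 hx.le).trans (hxz z hz)
  have hUν : ∀ z : ℂ, ‖z‖ < 1 → 0 ≤ poissonExt ν z := fun z hz => hν.poissonExt_nonneg hz
  set V : (ℂ → ℂ) → ℝ := fun f => (form (distCoeff ν) 0 (taylorCoeff f)).re with hV
  set W : (ℂ → ℂ) → ℝ := fun f => (form (distCoeff (μ l)) (m - 1) (taylorCoeff f)).re with hW
  set S : (ℂ → ℂ) → ℝ := fun f => ∑' j : ℕ, (1 + (j : ℝ)) ^ (m - 1) * ‖taylorCoeff f j‖ ^ 2 with hS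
  have hV0 : ∀ f, IsSmoothAnalytic f → 0 ≤ V f := fun f hf => (hH ν).re_form_nonneg hUν hf 0
  have hW0 : ∀ f, IsSmoothAnalytic f → 0 ≤ W f := fun f hf =>
    (hH (μ l)).re_form_nonneg hUl hf (m - 1)
  obtain ⟨B, hB, hBf⟩ : ∃ B : ℝ, 0 ≤ B ∧ ∀ f, IsSmoothAnalytic f → S f ≤ B * (V f + W f) := by
    refine exists_tsum_one_add_pow_le (hH ν) hUν hK.le (fun f hf => ?_) (hH (μ l)) hx hxz (m - 1)
    have := (Complex.le_def.1 (hKf f hf)).1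
    rwa [Complex.ofReal_re, dirichletIntegral_eq_form ν 0 hf, Complex.re_ofReal_mul] at this
  -- With weight exponent p = m-1, growth s is admissible at position n when s ≤ (m-3)/2 and n + s ≤
  -- m-2. For large n, s = m-2-n attains the second bound, and the first is then equivalent to n ≥
  -- (m-1)/2.
  have hbound : ∀ n : Fin m, n ≠ l → ∃ L : ℝ, 0 ≤ L ∧ ∀ a : ℕ → ℂ, RapidDecay a →
      ‖form (distCoeff (μ n)) n a‖ ≤ L * ∑' j : ℕ, (1 + (j : ℝ)) ^ (m - 1) * ‖a j‖ ^ 2 := by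
    intro n hn
    have hnm : (n : ℕ) ≤ m - 2 := by
      have := n.2
      have h2 : (n : ℕ) ≠ m - 1 := fun h => hn (Fin.ext h)
      omega
    by_cases h1 : ((m : ℝ) - 1) / 2 ≤ (n : ℝ)
    · obtain ⟨L, hL, h⟩ := (hhigh n h1 hnm).exists_norm_distCoeff_le
      have hc : ((m - 2 - n : ℕ) : ℝ) = (m : ℝ) - 2 - n := by
        rw [Nat.cast_sub hnm, Nat.cast_sub (by omega), Nat.cast_ofNat]
      exact exists_norm_form_le (polyBdd_distCoeff _) hL (by positivity)
        (by rw [hp, hc]; linarith) (by rw [hp, hc]; linarith) h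
    by_cases h2 : (n : ℝ) ≤ ((m : ℝ) - 3) / 2
    · obtain ⟨L, hL, h⟩ := hlow n h2
      exact exists_norm_form_le (polyBdd_distCoeff _) hL.le (by linarith)
        (by rw [hp]; linarith) (by rw [hp]; linarith) h
    -- Outside both ranges m-3 < 2n < m-1, so m is even and n is the middle position; there s =
    -- (m-4)/2.
    · have h3 : 2 * (n : ℕ) + 2 = m := by
        have e1 : 2 * (n : ℕ) + 1 < m := by
          have : 2 * (n : ℝ) + 1 < m := by linarith
          exact_mod_cast this
        have e2 : m < 2 * (n : ℕ) + 3 := by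
          have : (m : ℝ) < 2 * (n : ℝ) + 3 := by linarith
          exact_mod_cast this
        omega
      obtain ⟨L, hL, h⟩ := (hmid n ⟨n + 1, by omega⟩ (by omega)).exists_norm_distCoeff_le
      have hc : (((m - 4) / 2 : ℕ) : ℝ) = ((m : ℝ) - 4) / 2 := by
        have : 2 * ((m - 4) / 2) + 4 = m := by omega
        have : 2 * (((m - 4) / 2 : ℕ) : ℝ) + 4 = m := by exact_mod_cast this
        linarith
      have hn2 : 2 * (n : ℝ) + 2 = m := by exact_mod_cast h3
      exact exists_norm_form_le (polyBdd_distCoeff _) hL (by positivity)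
        (by rw [hp, hc]; linarith) (by rw [hp, hc]; linarith) h
  -- This is the form that Pascal's rule adds to W under the shift. Positivity of the last weight
  -- gives s = 0, and m ≥ 3 makes this admissible at order m-2.
  obtain ⟨B₃, hB₃, hB₃a⟩ : ∃ L : ℝ, 0 ≤ L ∧ ∀ a : ℕ → ℂ, RapidDecay a →
      ‖form (distCoeff (μ l)) (m - 2) a‖ ≤
        L * ∑' j : ℕ, (1 + (j : ℝ)) ^ (m - 1) * ‖a j‖ ^ 2 := by
    refine exists_norm_form_le (polyBdd_distCoeff _) (norm_nonneg (distCoeff (μ l) 0)) le_rfl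
      (by rw [hp]; linarith) ?_ fun k => ?_
    · rw [hp, Nat.cast_sub (by omega), Nat.cast_ofNat]
      linarith
    · rw [Real.rpow_zero, mul_one]
      exact (hH (μ l)).norm_coeff_le hUl k
  choose! L hL hLa using hbound
  set R : (ℂ → ℂ) → ℝ := fun f =>
    ∑ n ∈ Finset.univ.erase l, (form (distCoeff (μ n)) n (taylorCoeff f)).re with hR
  set B₂ : ℝ := (∑ n ∈ Finset.univ.erase l, L n) * B with hB₂
  have hLsum : 0 ≤ ∑ n ∈ Finset.univ.erase l, L n :=
    Finset.sum_nonneg fun n hn => hL n (Finset.ne_of_mem_erase hn)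
  have hB₂0 : 0 ≤ B₂ := mul_nonneg hLsum hB
  have hRf : ∀ f, IsSmoothAnalytic f → |R f| ≤ B₂ * (V f + W f) := by
    intro f hf
    have h1 : |R f| ≤ (∑ n ∈ Finset.univ.erase l, L n) * S f := by
      rw [Finset.sum_mul]
      refine (Finset.abs_sum_le_sum_abs _ _).trans (Finset.sum_le_sum fun n hn => ?_)
      exact (Complex.abs_re_le_norm _).trans (hLa n (Finset.ne_of_mem_erase hn) _ hf.rapidDecay)
    rw [hB₂, mul_assoc]
    exact h1.trans (mul_le_mul_of_nonneg_left (hBf f hf) hLsum)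
  have hform : ∀ (C : ℝ) (f), IsSmoothAnalytic f →
      dirichletForm (Pi.single ⟨0, by omega⟩ ((C : ℂ) • ν) + μ +
        Pi.single l ((C : ℂ) • μ l)) f = ((C * V f + (W f + R f) + C * W f : ℝ) : ℂ) := by
    intro C f hf
    have hre : ∀ n : Fin m, form (distCoeff (μ n)) n (taylorCoeff f) =
        ((form (distCoeff (μ n)) n (taylorCoeff f)).re : ℂ) := fun n => Complex.ext rfl (by
      simpa using (hH (μ n)).im_form_eq_zero (fun z hz => (hreal n).poissonExt_im hz) hf n)
    have hreν : form (distCoeff ν) 0 (taylorCoeff f) = (V f : ℂ) := Complex.ext rfl (by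
      simpa using (hH ν).im_form_eq_zero
        (fun z hz => ((Complex.nonneg_iff.1 (hUν z hz)).2).symm) hf 0)
    have hrel : form (distCoeff (μ l)) l (taylorCoeff f) = (W f : ℂ) := hre l
    have hsum : ∑ n : Fin m, form (distCoeff (μ n)) n (taylorCoeff f) = ((W f + R f : ℝ) : ℂ) := by
      rw [← Finset.add_sum_erase _ _ (Finset.mem_univ l), hrel, hR, Complex.ofReal_add,
        Complex.ofReal_sum]
      congr 1
      exact Finset.sum_congr rfl fun n _ => hre n
    rw [dirichletForm_single_add_single _ _ _ _ _ _ hf, hsum, hrel]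
    change (C : ℂ) * form (distCoeff ν) 0 (taylorCoeff f) + _ + _ = _
    rw [hreν]
    push_cast
    ring
  have hVz : ∀ f, IsSmoothAnalytic f → V (fun z => z * f z) = V f := fun f hf => by
    simp only [hV]
    rw [form_shift_zero _ hf.taylorCoeff_id_mul_zero (taylorCoeff_id_mul_succ f)]
  have hWz : ∀ f, IsSmoothAnalytic f → W (fun z => z * f z) ≤ W f + B₃ * B * (V f + W f) := by
    intro f hf
    have h1 := form_shift_succ (polyBdd_distCoeff (μ l)) (m - 2) hf.rapidDecay
      hf.taylorCoeff_id_mul_zero (taylorCoeff_id_mul_succ f)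
    rw [show m - 2 + 1 = m - 1 by omega] at h1
    have h2 : (form (distCoeff (μ l)) (m - 2) (taylorCoeff f)).re ≤ B₃ * B * (V f + W f) := by
      rw [mul_assoc]
      exact (Complex.re_le_norm _).trans ((hB₃a _ hf.rapidDecay).trans
        (mul_le_mul_of_nonneg_left (hBf f hf) hB₃))
    simp only [hW, h1, Complex.add_re]
    linarith
  -- C must absorb |R| ≤ B₂(V+W) and leave one copy of V + W.
  refine ⟨B₂ + 1, by positivity, fun C hC => ?_⟩
  have hC0 : 0 ≤ C := by linarith
  have hA : 0 < (C + 1 + B₂) * (1 + B₃ * B) := by positivity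
  -- The first factor bounds the whole form by V + W, the second the growth of V + W under
  -- multiplication by z. The root appears because allowability asks for the square of the constant.
  refine ⟨√((C + 1 + B₂) * (1 + B₃ * B)), Real.sqrt_pos.2 hA, fun f hf => ?_⟩
  have hlower : ∀ g, IsSmoothAnalytic g → V g + W g ≤ C * V g + (W g + R g) + C * W g := by
    intro g hg
    have h1 := neg_le_of_abs_le (hRf g hg)
    have h2 := hV0 g hg
    have h3 := hW0 g hg
    nlinarith [mul_le_mul_of_nonneg_right hC (add_nonneg h2 h3)]
  have hzf := hf.id_mul
  have v0 := hV0 f hf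
  have w0 := hW0 f hf
  have v1 := hV0 _ hzf
  have w1 := hW0 _ hzf
  rw [hform C _ hzf, hform C f hf]
  refine ⟨Complex.zero_le_real.2 ((add_nonneg v1 w1).trans (hlower _ hzf)), ?_⟩
  rw [← Complex.ofReal_pow, Real.sq_sqrt hA.le, ← Complex.ofReal_mul, Complex.real_le_real]
  have h1 := le_of_abs_le (hRf _ hzf)
  have h2 := hVz f hf
  have h3 := hWz f hf
  set v := V f
  set w := W f
  set w' := W fun z => z * f z
  set r := R fun z => z * f z
  rw [h2] at h1 ⊢
  have h4 : v + w' ≤ (1 + B₃ * B) * (v + w) := by linarith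
  calc C * v + (w' + r) + C * w' ≤ (C + 1 + B₂) * (v + w') := by linarith
    _ ≤ (C + 1 + B₂) * ((1 + B₃ * B) * (v + w)) := mul_le_mul_of_nonneg_left h4 (by positivity)
    _ ≤ (C + 1 + B₂) * ((1 + B₃ * B) * (C * v + (w + R f) + C * w)) := by
        have := hlower f hf
        exact mul_le_mul_of_nonneg_left (mul_le_mul_of_nonneg_left this (by positivity))
          (by positivity)
    _ = _ := by ring
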